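/- Let $\mathbb{H}_+=\{\zeta\in\mathbb{C}:\operatorname{Im}\zeta>0\}$, and let $H^2$ be the Hardy space of functions $f$ analytic in $\mathbb{H}_+$ with $\sup_{y>0}\|f(\cdot+iy)\|_{L^2(\mathbb{R})}<\infty$, with norm $\|f\|_{H^2}=\|f\|_{L^2(\mathbb{R})}$, the $L^2(\mathbb{R})$ norm of the boundary data of $f$ (the limit of $f(\cdot+iy)$ in $L^2(\mathbb{R})$ as $y\downarrow0$). Let $\Gamma\subset\mathbb{H}_+$ be a compact, simple, smooth ($C^1$, regular) curve, either an arc or a closed curve, let $L^2(\Gamma)=L^2(\Gamma,|d\tau|)$ be taken with respect to arc length, let $z\in\mathbb{H}_+\setminus\Gamma$ and $\epsilon>0$. Put $$(\mathcal{K}u)(\zeta)=\frac{1}{2\pi}\int_\Gamma\frac{i\,u(\tau)}{\zeta-\overline{\tau}}\,|d\tau|,\qquad p_z(\zeta)=\frac{i}{\zeta-\overline{z}},\qquad \zeta\in\mathbb{H}_+.$$ Then the integral equation $$(\mathcal{K}u)(\zeta)+\epsilon^2u(\zeta)=p_z(\zeta),\qquad\zeta\in\Gamma,$$ has a unique solution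 $u=u_{\epsilon,z}$ in $L^2(\Gamma)$. Extended to $\mathbb{H}_+$ by $u(\zeta)=\epsilon^{-2}\bigl(p_z(\zeta)-(\mathcal{K}u)(\zeta)\bigr)$, it belongs to $H^2$; moreover $\|u\|_{H^2}>0$, $\|u\|_{L^2(\Gamma)}>0$, and $u(z)$ is real and positive. Every $f\in H^2$ with $\|f\|_{H^2}\le1$ and $\|f\|_{L^2(\Gamma)}\le\epsilon$ satisfies $$|f(z)|\le\frac32\,u_{\epsilon,z}(z)\,\min\left\{\frac{1}{\|u_{\epsilon,z}\|_{H^2}},\frac{\epsilon}{\|u_{\epsilon,z}\|_{L^2(\Gamma)}}\right\}.$$ The bound is sharp up to the factor $3/2$: the function $$M_{\epsilon,z}(\zeta)=u_{\epsilon,z}(\zeta)\,\min\left\{\frac{1}{\|u_{\epsilon,z}\|_{H^2}},\frac{\epsilon}{\|u_{\epsilon,z}\|_{L^2(\Gamma)}}\right\}$$ belongs to $H^2$ and satisfies $\|M_{\epsilon,z}\|_{H^2}\le1$, $\|M_{\epsilon,z}\|_{L^2(\Gamma)}\le\epsilon$ and $|M_{\epsilon,z}(z)|=u_{\epsilon,z}(z)\min\{1/\|u_{\epsilon,z}\|_{H^2},\,\epsilon/\|u_{\epsilon,z}\|_{L^2(\Gamma)}\}$.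 -/

import Mathlib

open MeasureTheory Set Filter Topology
open scoped ENNReal

noncomputable section

/-- The open upper half-plane `ℍ₊`, as a subset of `ℂ`. -/
def upperHalf : Set ℂ := {ζ | 0 < ζ.im}

/-- `γ` on `[a, b]` is a regular `C¹` parametrization of a compact simple curve, which is either an
arc or a closed curve (in the closed case the tangent also has to match at the base point). -/
structure IsSimpleC1Curve (γ : ℝ → ℂ) (a b : ℝ) : Prop where
  lt : a < b
  contDiffOn : ContDiffOn ℝ 1 γ (Icc a b)
  regular : ∀ t ∈ Icc a b, derivWithin γ (Icc a b) t ≠ 0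
  simple : InjOn γ (Icc a b) ∨
    (InjOn γ (Ico a b) ∧ γ a = γ b ∧
      derivWithin γ (Icc a b) a = derivWithin γ (Icc a b) b)

/-- The arc length measure `|dτ|` on the curve `γ '' [a, b]`: the image under `γ` of
`|γ'(t)| dt` on `[a, b]`. -/
def arcLength (γ : ℝ → ℂ) (a b : ℝ) : Measure ℂ :=
  ((volume.restrict (Icc a b)).withDensity
    (fun t => ‖derivWithin γ (Icc a b) t‖ₑ)).map γ

/-- The `L²` norm with respect to the measure `σ`. -/
def normL2 {α : Type*} [MeasurableSpace α] (σ : Measure α) (f : α → ℂ) : ℝ :=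
  (eLpNorm f 2 σ).toReal

/-- The Hardy space `H²(ℍ₊)`: functions analytic in the upper half-plane whose `L²` norms on
horizontal lines are bounded. Values outside `ℍ₊` are irrelevant. -/
def MemHardy (f : ℂ → ℂ) : Prop :=
  DifferentiableOn ℂ f upperHalf ∧
    (⨆ (y : ℝ) (_ : 0 < y),
      eLpNorm (fun x : ℝ => f (x + y * Complex.I)) 2 (volume : Measure ℝ)) < ∞

/-- `g` is the `L²(ℝ)` boundary data of `f`: `f(· + iy) → g` in `L²(ℝ)` as `y ↓ 0`. -/
def IsBoundaryData (f : ℂ → ℂ) (g : ℝ → ℂ) : Prop :=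
  MemLp g 2 (volume : Measure ℝ) ∧
    Tendsto (fun y : ℝ =>
      eLpNorm (fun x : ℝ => f (x + y * Complex.I) - g x) 2 (volume : Measure ℝ))
      (𝓝[>] 0) (𝓝 0)

open Classical in
/-- The boundary data of `f` (unique up to null sets; `0` if there is none, which does not happen
for functions in `H²`). -/
def boundaryData (f : ℂ → ℂ) : ℝ → ℂ :=
  if h : ∃ g, IsBoundaryData f g then h.choose else 0

/-- The norm of `H²(ℍ₊)`: the `L²(ℝ)` norm of the boundary data. -/
def hardyNorm (f : ℂ → ℂ) : ℝ :=
  normL2 (volume : Measure ℝ) (boundaryData f)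

/-- `(𝒦u)(ζ) = (1/2π) ∫ i u(τ) / (ζ - τ̄) |dτ|`. -/
def opK (σ : Measure ℂ) (u : ℂ → ℂ) (ζ : ℂ) : ℂ :=
  (1 / (2 * Real.pi) : ℂ) *
    ∫ τ, Complex.I * u τ / (ζ - (starRingEnd ℂ) τ) ∂σ

/-- `p_z(ζ) = i / (ζ - z̄)`. -/
def fnP (z ζ : ℂ) : ℂ := Complex.I / (ζ - (starRingEnd ℂ) z)

/-- `w` is an `L²(Γ)` solution of `𝒦w + ε²w = p_z` on `Γ`. -/
def IsSolution (σ : Measure ℂ) (ε : ℝ) (z : ℂ) (w : ℂ → ℂ) : Prop :=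
  MemLp w 2 σ ∧ ∀ᵐ ζ ∂σ, opK σ w ζ + (ε : ℂ) ^ 2 * w ζ = fnP z ζ

/-- The function that a solution `w` on `Γ` defines off `Γ` by the integral equation, that is
`u(ζ) = ε⁻² (p_z(ζ) - (𝒦w)(ζ))`. On `Γ` it agrees with `w` almost everywhere. -/
def extendSol (σ : Measure ℂ) (ε : ℝ) (z : ℂ) (w : ℂ → ℂ) (ζ : ℂ) : ℂ :=
  (fnP z ζ - opK σ w ζ) / (ε : ℂ) ^ 2

/-- `min {1 / ‖u‖_{H²}, ε / ‖u‖_{L²(Γ)}}`. -/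
def minFactor (σ : Measure ℂ) (ε : ℝ) (u : ℂ → ℂ) : ℝ :=
  min (1 / hardyNorm u) (ε / normL2 σ u)

end

/-! The kernels `p_ζ` reproduce: pairing the boundary data of `f ∈ H²` with `p_ζ` in `L²(ℝ)` gives
`2π f(ζ)` (`MemHardy.cauchy_formula`). Since `𝒦w` is the average `(1/2π) ∫ w(τ) p_τ |dτ|`, Fubini
turns this into the statement that `𝒦 : L²(Γ) → L²(ℝ)` is adjoint to the restriction of `H²`
functions to `Γ` (`integral_conj_opK_mul`). Hence `𝒦` on `L²(Γ)` has the form `S* S`, so `𝒦 + ε²` is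
coercive and therefore invertible (`exists_isUnit_opK_add`). This gives existence and uniqueness.

Pairing `ε² u = p_z - 𝒦u` with `f` yields `(f, u)_Γ + ε² (f, u)_{H²} = 2π f(z)`
(`integral_extendSol`). Write `A`, `B` for the norms of `u` in `L²(Γ)` and `H²`. Taking `f = u`
gives `2π u(z) = A² + ε² B²`, while Cauchy-Schwarz gives `2π |f(z)| ≤ ε A + ε² B` for admissible
`f`. Comparing the two is a quadratic inequality in `A` and `ε B`, and it holds with the constant
`3/2`.

The Hardy space theory rests on shifting horizontal contours. The inner product of `f(· + iy)` and
`f(· + is)` in `L²(ℝ)` depends only on `y + s`, so the distance of two slices is expressed through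
`N(y) = ‖f(· + iy)‖²`. This `N` is midpoint convex and bounded, hence nonincreasing with a limit at
`0`; the slices are therefore Cauchy and boundary data exist. -/

/-! ### Shifting horizontal contours. -/

/-- A function holomorphic in a horizontal strip, continuous up to its boundary, whose `L¹` norms on
horizontal lines are uniformly bounded away from a compact set has the same integral over the two
boundary lines. -/
theorem integral_line_eq_of_strip {h : ℂ → ℂ} {c d : ℝ} (hcd : c ≤ d)
    (hcont : ContinuousOn h (Complex.im ⁻¹' Icc c d))
    (hdiff : DifferentiableOn ℂ h (Complex.im ⁻¹' Ioo c d))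
    (hc : Integrable (fun x : ℝ => h (x + c * Complex.I)))
    (hd : Integrable (fun x : ℝ => h (x + d * Complex.I)))
    (R₀ : ℝ) (C : ℝ≥0∞) (hC : C ≠ ∞)
    (hbd : ∀ y ∈ Icc c d,
      eLpNorm (fun x : ℝ => h (x + y * Complex.I)) 1 (volume.restrict {x | R₀ ≤ |x|}) ≤ C) :
    ∫ x : ℝ, h (x + c * Complex.I) = ∫ x : ℝ, h (x + d * Complex.I) := by
  have hmS : MeasurableSet {x : ℝ | R₀ ≤ |x|} := measurableSet_le measurable_const measurable_norm
  set μ := (volume : Measure ℝ).restrict {x | R₀ ≤ |x|} with hμ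
  set ν := (volume : Measure ℝ).restrict (Icc c d) with hν
  have hmeas : AEStronglyMeasurable (fun p : ℝ × ℝ => h (p.1 + p.2 * Complex.I)) (μ.prod ν) := by
    rw [hμ, hν, Measure.prod_restrict]
    refine ContinuousOn.aestronglyMeasurable ?_ (hmS.prod measurableSet_Icc)
    refine hcont.comp (by fun_prop) ?_
    rintro ⟨x, y⟩ ⟨-, hy⟩
    simpa using hy
  have hinteg : Integrable (fun p : ℝ × ℝ => h (p.1 + p.2 * Complex.I)) (μ.prod ν) := by
    refine ⟨hmeas, ?_⟩
    rw [hasFiniteIntegral_iff_enorm, lintegral_prod_symm _ hmeas.enorm]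
    calc ∫⁻ y, ∫⁻ x, ‖h (x + y * Complex.I)‖ₑ ∂μ ∂ν
        ≤ ∫⁻ y, C ∂ν := by
          refine lintegral_mono_ae ?_
          filter_upwards [ae_restrict_mem measurableSet_Icc] with y hy
          simpa [eLpNorm_one_eq_lintegral_enorm] using hbd y hy
      _ < ∞ := by
          simp only [lintegral_const, hν, Measure.restrict_apply_univ]
          exact ENNReal.mul_lt_top hC.lt_top (by simp)
  set H : ℝ → ℂ := fun x => ∫ y in c..d, h (x + y * Complex.I) with hH
  have hHint : IntegrableOn H {x | R₀ ≤ |x|} := by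
    have := hinteg.integral_prod_left
    refine this.congr (ae_of_all _ fun x => ?_)
    simp only [hH, hν]
    rw [intervalIntegral.integral_of_le hcd, integral_Icc_eq_integral_Ioc]
  -- No pointwise decay of `h` is available. The vertical sides are integrable in `R` by Fubini, and
  -- the rectangle identity makes their difference converge; an integrable function with a limit at
  -- infinity has limit `0`.
  have hV : IntegrableAtFilter (fun R => H R - H (-R)) atTop volume := by
    refine ⟨Ici (max R₀ 0), Ici_mem_atTop _, ?_⟩
    have h1 : IntegrableOn H (Ici (max R₀ 0)) := hHint.mono_set fun x hx => by
      simp only [mem_Ici, sup_le_iff] at hx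
      simpa [abs_of_nonneg hx.2] using hx.1
    have h2 : IntegrableOn H (Iic (-(max R₀ 0))) := hHint.mono_set fun x hx => by
      have hx' : max R₀ 0 ≤ -x := le_neg_of_le_neg (mem_Iic.mp hx)
      simp only [sup_le_iff] at hx'
      simpa [abs_of_nonpos (neg_nonneg.mp hx'.2)] using hx'.1
    refine h1.sub ?_
    have := (Measure.measurePreserving_neg (volume : Measure ℝ)).integrableOn_comp_preimage
      (Homeomorph.neg ℝ).measurableEmbedding (f := H) (s := Iic (-(max R₀ 0)))
    have h3 := this.2 h2
    simpa [Function.comp_def] using h3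
  have hrect : ∀ R : ℝ, 0 ≤ R → H R - H (-R) =
      Complex.I * ((∫ x in (-R)..R, h (x + c * Complex.I)) -
        ∫ x in (-R)..R, h (x + d * Complex.I)) := by
    intro R hR
    have := Complex.integral_boundary_rect_eq_zero_of_continuousOn_of_differentiableOn h
      ⟨-R, c⟩ ⟨R, d⟩ (hcont.mono ?_) (hdiff.mono ?_)
    · change _ - _ + Complex.I • H R - Complex.I • H (-R) = 0 at this
      simp only [smul_eq_mul] at this
      linear_combination (-Complex.I) * this + (H R - H (-R)) * Complex.I_mul_I
    · intro w hw
      have := hw.2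
      rwa [uIcc_of_le hcd] at this
    · intro w hw
      have := hw.2
      simpa [hcd] using this
  have hlim : Tendsto (fun R => H R - H (-R)) atTop
      (𝓝 (Complex.I * ((∫ x : ℝ, h (x + c * Complex.I)) - ∫ x : ℝ, h (x + d * Complex.I)))) := by
    refine Tendsto.congr' (f₁ := fun R : ℝ => Complex.I *
      ((∫ x in (-R)..R, h (x + c * Complex.I)) - ∫ x in (-R)..R, h (x + d * Complex.I))) ?_ ?_
    · filter_upwards [eventually_ge_atTop 0] with R hR using (hrect R hR).symm
    · exact ((intervalIntegral_tendsto_integral hc tendsto_neg_atTop_atBot tendsto_id).sub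
        (intervalIntegral_tendsto_integral hd tendsto_neg_atTop_atBot tendsto_id)).const_mul _
  have h0 := hV.eq_zero_of_tendsto (fun s hs => ?_) hlim
  · have := (mul_eq_zero.mp h0).resolve_left Complex.I_ne_zero
    exact sub_eq_zero.mp this
  · obtain ⟨N, hN⟩ := mem_atTop_sets.mp hs
    refine top_unique ?_
    calc ∞ = volume (Ici N) := by simp
      _ ≤ volume s := measure_mono fun x hx => hN x hx

/-! ### Cauchy kernels on horizontal lines. -/

theorem isOpen_upperHalf : IsOpen upperHalf := isOpen_lt continuous_const Complex.continuous_im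

theorem integrable_inv_sub_sq_add_sq (ξ : ℝ) {s : ℝ} (hs : s ≠ 0) :
    Integrable (fun x : ℝ => ((x - ξ) ^ 2 + s ^ 2)⁻¹) := by
  have h := ((integrable_inv_one_add_sq.comp_mul_left' (inv_ne_zero hs)).comp_sub_right ξ).const_mul
    ((s ^ 2)⁻¹)
  refine h.congr (ae_of_all _ fun x => ?_)
  simp only
  rw [← mul_inv]
  congr 1
  field_simp
  ring

theorem integral_inv_sub_sq_add_sq (ξ : ℝ) {s : ℝ} (hs : s ≠ 0) :
    ∫ x : ℝ, ((x - ξ) ^ 2 + s ^ 2)⁻¹ = Real.pi / |s| := by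
  have h : ∀ x : ℝ, ((x - ξ) ^ 2 + s ^ 2)⁻¹ = (s ^ 2)⁻¹ * (1 + (s⁻¹ * (x - ξ)) ^ 2)⁻¹ := by
    intro x
    rw [← mul_inv]
    congr 1
    field_simp
    ring
  simp_rw [h]
  rw [integral_const_mul, integral_sub_right_eq_self (fun x : ℝ => (1 + (s⁻¹ * x) ^ 2)⁻¹) ξ,
    Measure.integral_comp_mul_left (fun x : ℝ => (1 + x ^ 2)⁻¹), integral_univ_inv_one_add_sq,
    inv_inv, smul_eq_mul, ← sq_abs s]
  have : |s| ≠ 0 := abs_ne_zero.mpr hs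
  field_simp

theorem norm_inv_ofReal_sub_sq (x : ℝ) (b : ℂ) :
    ‖((x : ℂ) - b)⁻¹‖ ^ 2 = ((x - b.re) ^ 2 + b.im ^ 2)⁻¹ := by
  rw [norm_inv, inv_pow, ← Complex.normSq_eq_norm_sq, Complex.normSq_apply]
  simp [pow_two]

theorem ofReal_sub_ne_zero {b : ℂ} (hb : b.im ≠ 0) (x : ℝ) : (x : ℂ) - b ≠ 0 := fun h => hb <| by
  simpa using congrArg Complex.im h

theorem memLp_inv_ofReal_sub {b : ℂ} (hb : b.im ≠ 0) :
    MemLp (fun x : ℝ => ((x : ℂ) - b)⁻¹) 2 := by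
  have hc : Continuous fun x : ℝ => ((x : ℂ) - b)⁻¹ :=
    (by fun_prop : Continuous fun x : ℝ => (x : ℂ) - b).inv₀ (ofReal_sub_ne_zero hb)
  rw [memLp_two_iff_integrable_sq_norm hc.aestronglyMeasurable]
  simp_rw [norm_inv_ofReal_sub_sq]
  exact integrable_inv_sub_sq_add_sq _ hb

theorem eLpNorm_inv_ofReal_sub {b : ℂ} (hb : b.im ≠ 0) :
    eLpNorm (fun x : ℝ => ((x : ℂ) - b)⁻¹) 2 = ENNReal.ofReal (√(Real.pi / |b.im|)) := by
  rw [(memLp_inv_ofReal_sub hb).eLpNorm_eq_integral_rpow_norm two_ne_zero ENNReal.ofNat_ne_top]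
  congr 1
  simp only [ENNReal.toReal_ofNat, Real.rpow_two, norm_inv_ofReal_sub_sq]
  rw [integral_inv_sub_sq_add_sq _ hb, Real.sqrt_eq_rpow]
  norm_num

/-- Hölder's inequality for the product of two functions in `L²`. -/
theorem eLpNorm_one_mul_le {α : Type*} [MeasurableSpace α] {μ : Measure α} {f g : α → ℂ}
    (hf : AEStronglyMeasurable f μ) (hg : AEStronglyMeasurable g μ) :
    eLpNorm (fun x => f x * g x) 1 μ ≤ eLpNorm f 2 μ * eLpNorm g 2 μ := by
  have h := eLpNorm_smul_le_mul_eLpNorm (p := 2) (q := 2) (r := 1) hg hf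
  rwa [smul_eq_mul] at h

theorem continuous_line_of_continuousOn {f : ℂ → ℂ} {s : Set ℂ} (hf : ContinuousOn f s) {y : ℝ}
    (h : ∀ x : ℝ, (x : ℂ) + y * Complex.I ∈ s) : Continuous fun x : ℝ => f (x + y * Complex.I) :=
  hf.comp_continuous (by fun_prop) h

theorem norm_ofReal_add_I_le (x : ℝ) {ξ : ℝ} (hx : 1 ≤ |x - ξ|) :
    ‖(x : ℂ) - -Complex.I‖ ≤ (|ξ| + 2) * |x - ξ| := by
  have h : (x : ℂ) - -Complex.I = ((x - ξ : ℝ) : ℂ) + (ξ : ℂ) + Complex.I := by push_cast; ring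
  rw [h]
  refine (norm_add₃_le).trans ?_
  simp only [Complex.norm_real, Complex.norm_I, Real.norm_eq_abs]
  nlinarith [abs_nonneg ξ]

theorem eLpNorm_const_mul {α : Type*} [MeasurableSpace α] {μ : Measure α} (c : ℂ) (f : α → ℂ)
    (p : ℝ≥0∞) : eLpNorm (fun x => c * f x) p μ = ‖c‖ₑ * eLpNorm f p μ :=
  eLpNorm_const_smul c f p μ

/-- At horizontal distance at least `1` from the pole, the real part alone controls the kernel, so
the comparison with `1 / (x + i)` is uniform in the height `y`. -/
theorem norm_inv_ofReal_add_sub_le (x y : ℝ) {ζ : ℂ} (hx : |ζ.re| + 1 ≤ |x|) :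
    ‖((x : ℂ) + y * Complex.I - ζ)⁻¹‖ ≤
      ‖((|ζ.re| + 2 : ℝ) : ℂ) * ((x : ℂ) - -Complex.I)⁻¹‖ := by
  have h1 : 1 ≤ |x - ζ.re| := by
    have := abs_sub_abs_le_abs_sub x ζ.re
    linarith
  have hre : |x - ζ.re| ≤ ‖(x : ℂ) + y * Complex.I - ζ‖ := by
    have := Complex.abs_re_le_norm ((x : ℂ) + y * Complex.I - ζ)
    simpa using this
  rw [norm_mul, norm_inv, norm_inv, Complex.norm_real,
    Real.norm_of_nonneg (by positivity : (0:ℝ) ≤ |ζ.re| + 2)]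
  have h2 := norm_ofReal_add_I_le x h1
  have hpos : 0 < ‖(x : ℂ) - -Complex.I‖ := norm_pos_iff.mpr (ofReal_sub_ne_zero (by simp) x)
  rw [← div_eq_mul_inv, inv_le_comm₀ (by linarith) (by positivity), inv_div,
    div_le_iff₀ (by positivity), mul_comm]
  refine h2.trans ?_
  gcongr

/-- Supplies the uniform `L¹` bound required by `integral_line_eq_of_strip`, including on the line
through `ζ`, where the kernel itself is not in `L²`. -/
theorem eLpNorm_mul_inv_sub_far_le {g : ℝ → ℂ} (hg : AEStronglyMeasurable g) (y : ℝ) (ζ : ℂ) :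
    eLpNorm (fun x : ℝ => g x * ((x : ℂ) + y * Complex.I - ζ)⁻¹) 1
      (volume.restrict {x | |ζ.re| + 1 ≤ |x|}) ≤
        eLpNorm g 2 * (‖((|ζ.re| + 2 : ℝ) : ℂ)‖ₑ *
          eLpNorm (fun x : ℝ => ((x : ℂ) - -Complex.I)⁻¹) 2) := by
  have hmS : MeasurableSet {x : ℝ | |ζ.re| + 1 ≤ |x|} :=
    measurableSet_le measurable_const measurable_norm
  have hm : AEStronglyMeasurable (fun x : ℝ => ((x : ℂ) - -Complex.I)⁻¹) volume :=
    (memLp_inv_ofReal_sub (by simp)).aestronglyMeasurable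
  rw [← eLpNorm_const_mul]
  refine le_trans ?_ (eLpNorm_one_mul_le hg (hm.const_mul _))
  refine le_trans ?_ (eLpNorm_mono_measure _
    (Measure.restrict_le_self (s := {x : ℝ | |ζ.re| + 1 ≤ |x|})))
  refine eLpNorm_mono_ae ?_
  filter_upwards [ae_restrict_mem hmS] with x hx
  rw [norm_mul, norm_mul]
  gcongr
  exact norm_inv_ofReal_add_sub_le x y hx

/-! ### Cauchy's formula for functions continuous up to the real line. -/

/-- If `G` is continuous in the closed upper half-plane, holomorphic inside, with bounded `L²` norms
on horizontal lines, and vanishes at `ζ`, then the Cauchy integral of `G` at `ζ` vanishes. -/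
theorem integral_mul_inv_sub_eq_zero {G : ℂ → ℂ} (hc : ContinuousOn G {w | 0 ≤ w.im})
    (hd : DifferentiableOn ℂ G upperHalf) {C : ℝ≥0∞} (hC : C ≠ ∞)
    (hb : ∀ y : ℝ, 0 ≤ y → eLpNorm (fun x : ℝ => G (x + y * Complex.I)) 2 ≤ C)
    {ζ : ℂ} (hζ : ζ ∈ upperHalf) (h0 : G ζ = 0) :
    ∫ x : ℝ, G x * ((x : ℂ) - ζ)⁻¹ = 0 := by
  have hη : 0 < ζ.im := hζ
  have hnhds : upperHalf ∈ 𝓝 ζ := isOpen_upperHalf.mem_nhds hζ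
  have hnhds' : {w : ℂ | 0 ≤ w.im} ∈ 𝓝 ζ := mem_of_superset hnhds fun w (hw : 0 < w.im) => hw.le
  set h := dslope G ζ with hh
  have hhc : ContinuousOn h {w | 0 ≤ w.im} :=
    (continuousOn_dslope hnhds').2 ⟨hc, hd.differentiableAt hnhds⟩
  have hhd : DifferentiableOn ℂ h upperHalf := (Complex.differentiableOn_dslope hnhds).2 hd
  have hval : ∀ w, w ≠ ζ → h w = G w * (w - ζ)⁻¹ := by
    intro w hw
    rw [hh, dslope_of_ne _ hw, slope_def_field, h0, sub_zero, div_eq_mul_inv]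
  have hline : ∀ y : ℝ, y ≠ ζ.im → ∀ x : ℝ, h (x + y * Complex.I) =
      G (x + y * Complex.I) * ((x : ℂ) - (ζ - y * Complex.I))⁻¹ := by
    intro y hy x
    rw [hval]
    · congr 2; ring
    · intro he
      exact hy (by simpa using congrArg Complex.im he)
  have hGm : ∀ y : ℝ, 0 ≤ y → Continuous fun x : ℝ => G (x + y * Complex.I) := fun y hy =>
    continuous_line_of_continuousOn hc fun x => by simpa using hy
  have hhm : ∀ y : ℝ, 0 ≤ y → Continuous fun x : ℝ => h (x + y * Complex.I) := fun y hy =>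
    continuous_line_of_continuousOn hhc fun x => by simpa using hy
  have him : ∀ y : ℝ, (ζ - y * Complex.I).im = ζ.im - y := fun y => by simp
  have hmem : ∀ y : ℝ, y ≠ ζ.im → MemLp (fun x : ℝ => ((x : ℂ) - (ζ - y * Complex.I))⁻¹) 2 :=
    fun y hy => memLp_inv_ofReal_sub (by rw [him]; exact sub_ne_zero.mpr hy.symm)
  have hone : ∀ y : ℝ, 0 ≤ y → y ≠ ζ.im → eLpNorm (fun x : ℝ => h (x + y * Complex.I)) 1 ≤
      C * ENNReal.ofReal (√(Real.pi / |ζ.im - y|)) := by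
    intro y hy hy'
    simp_rw [hline y hy']
    refine (eLpNorm_one_mul_le (hGm y hy).aestronglyMeasurable
      (hmem y hy').aestronglyMeasurable).trans ?_
    rw [eLpNorm_inv_ofReal_sub (by rw [him]; exact sub_ne_zero.mpr hy'.symm), him]
    gcongr
    exact hb y hy
  have hinteg : ∀ y : ℝ, 0 ≤ y → y ≠ ζ.im → Integrable (fun x : ℝ => h (x + y * Complex.I)) := by
    intro y hy hy'
    rw [← memLp_one_iff_integrable]
    exact ⟨(hhm y hy).aestronglyMeasurable,
      (hone y hy hy').trans_lt (ENNReal.mul_lt_top hC.lt_top ENNReal.ofReal_lt_top)⟩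
  have hfar : ∀ y : ℝ, 0 ≤ y → eLpNorm (fun x : ℝ => h (x + y * Complex.I)) 1
      (volume.restrict {x | |ζ.re| + 1 ≤ |x|}) ≤ C * (‖((|ζ.re| + 2 : ℝ) : ℂ)‖ₑ *
        eLpNorm (fun x : ℝ => ((x : ℂ) - -Complex.I)⁻¹) 2) := by
    intro y hy
    have hmS : MeasurableSet {x : ℝ | |ζ.re| + 1 ≤ |x|} :=
      measurableSet_le measurable_const measurable_norm
    refine (eLpNorm_congr_ae ?_).le.trans ((eLpNorm_mul_inv_sub_far_le
      (hGm y hy).aestronglyMeasurable y ζ).trans (mul_le_mul_left (hb y hy) _))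
    filter_upwards [ae_restrict_mem hmS] with x hx
    refine hval _ fun he => ?_
    have h1 : x = ζ.re := by simpa using congrArg Complex.re he
    have hx' : |ζ.re| + 1 ≤ |x| := hx
    rw [h1] at hx'
    linarith
  have heq : ∀ Y : ℝ, ζ.im < Y → ∫ x : ℝ, h (x + (0 : ℝ) * Complex.I) =
      ∫ x : ℝ, h (x + Y * Complex.I) := by
    intro Y hY
    refine integral_line_eq_of_strip (hη.trans hY).le (hhc.mono fun w hw => hw.1)
      (hhd.mono fun w hw => hw.1) (hinteg 0 le_rfl hη.ne) (hinteg Y (hη.trans hY).le hY.ne')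
      (|ζ.re| + 1) _ ?_ fun y hy => hfar y hy.1
    refine ENNReal.mul_ne_top hC (ENNReal.mul_ne_top enorm_ne_top ?_)
    exact (memLp_inv_ofReal_sub (by simp)).eLpNorm_ne_top
  -- The Cauchy-Schwarz bound for the `L¹` norm at height `Y` decays because the `L²` norm of the
  -- kernel there is `√(π / |Im ζ - Y|)`.
  have hlim : Tendsto (fun Y : ℝ => C * ENNReal.ofReal (√(Real.pi / |ζ.im - Y|))) atTop (𝓝 0) := by
    have h1 : Tendsto (fun Y : ℝ => |ζ.im - Y|) atTop atTop :=
      tendsto_abs_atBot_atTop.comp (tendsto_atBot_add_const_left _ _ tendsto_neg_atTop_atBot)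
    have h2 := ENNReal.tendsto_ofReal ((h1.const_div_atTop Real.pi).sqrt)
    simp only [Real.sqrt_zero, ENNReal.ofReal_zero] at h2
    simpa using ENNReal.Tendsto.const_mul h2 (Or.inr hC)
  have hzero : ‖∫ x : ℝ, h (x + (0 : ℝ) * Complex.I)‖ₑ ≤ 0 := by
    refine ge_of_tendsto hlim ?_
    filter_upwards [eventually_gt_atTop ζ.im] with Y hY
    rw [heq Y hY]
    refine (enorm_integral_le_lintegral_enorm _).trans ?_
    rw [← eLpNorm_one_eq_lintegral_enorm]
    exact hone Y (hη.trans hY).le hY.ne'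
  have hz : ∫ x : ℝ, h (x + (0 : ℝ) * Complex.I) = 0 := by simpa using hzero
  rw [← hz]
  refine integral_congr_ae (ae_of_all _ fun x => ?_)
  simp only [hline 0 hη.ne x]
  simp

theorem conj_fnP (ζ : ℂ) (x : ℝ) :
    (starRingEnd ℂ) (fnP ζ x) = -Complex.I * ((x : ℂ) - ζ)⁻¹ := by
  simp [fnP, div_eq_mul_inv]

/-- The Cauchy formula for functions in `H²` which are continuous up to the boundary. -/
theorem cauchy_formula_of_continuousOn {F : ℂ → ℂ} (hc : ContinuousOn F {w | 0 ≤ w.im})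
    (hd : DifferentiableOn ℂ F upperHalf) {C : ℝ≥0∞} (hC : C ≠ ∞)
    (hb : ∀ y : ℝ, 0 ≤ y → eLpNorm (fun x : ℝ => F (x + y * Complex.I)) 2 ≤ C)
    {ζ : ℂ} (hζ : ζ ∈ upperHalf) :
    ∫ x : ℝ, (starRingEnd ℂ) (fnP ζ x) * F x = 2 * Real.pi * F ζ := by
  have hη : 0 < ζ.im := hζ
  set b := (starRingEnd ℂ) ζ with hbdef
  have hbim : b.im = -ζ.im := by simp [hbdef]
  -- A multiple of `p_ζ` normalized by `q ζ = 1`. Then `F - F ζ * q` vanishes at `ζ`, and the Cauchy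
  -- integral of `q` reduces to an explicit Poisson integral.
  set q : ℂ → ℂ := fun w => (ζ - b) * (w - b)⁻¹ with hq
  have hne : ∀ w : ℂ, 0 ≤ w.im → w - b ≠ 0 := by
    intro w hw he
    have := congrArg Complex.im he
    simp [hbim] at this
    linarith
  have hqc : ContinuousOn q {w | 0 ≤ w.im} :=
    continuousOn_const.mul ((continuousOn_id.sub continuousOn_const).inv₀ fun w hw => hne w hw)
  have hqd : DifferentiableOn ℂ q upperHalf :=
    (differentiableOn_const _).mul
      ((differentiableOn_id.sub (differentiableOn_const _)).inv fun w hw => hne w (le_of_lt hw))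
  have hqb : ∀ y : ℝ, 0 ≤ y → eLpNorm (fun x : ℝ => q (x + y * Complex.I)) 2 ≤
      ‖ζ - b‖ₑ * ENNReal.ofReal (√(Real.pi / ζ.im)) := by
    intro y hy
    have him : (b - y * Complex.I).im = -(ζ.im + y) := by simp [hbim]; ring
    have h1 : (fun x : ℝ => q (x + y * Complex.I)) =
        (ζ - b) • fun x : ℝ => ((x : ℂ) - (b - y * Complex.I))⁻¹ := by
      ext x
      simp only [hq, Pi.smul_apply, smul_eq_mul]
      congr 2
      ring
    rw [h1, eLpNorm_const_smul, eLpNorm_inv_ofReal_sub (by rw [him]; linarith), him, abs_neg,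
      abs_of_pos (by linarith)]
    gcongr
    linarith
  have hqζ : q ζ = 1 := mul_inv_cancel₀ (hne ζ hη.le)
  have hFl : ∀ y : ℝ, 0 ≤ y → Continuous fun x : ℝ => F (x + y * Complex.I) := fun y hy =>
    continuous_line_of_continuousOn hc fun x => by simpa using hy
  have hql : ∀ y : ℝ, 0 ≤ y → Continuous fun x : ℝ => q (x + y * Complex.I) := fun y hy =>
    continuous_line_of_continuousOn hqc fun x => by simpa using hy
  have hzero := integral_mul_inv_sub_eq_zero (G := fun w => F w - F ζ * q w)
    (hc.sub (continuousOn_const.mul hqc)) (hd.sub ((differentiableOn_const _).mul hqd))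
    (C := C + ‖F ζ‖ₑ * (‖ζ - b‖ₑ * ENNReal.ofReal (√(Real.pi / ζ.im))))
    (ENNReal.add_ne_top.2 ⟨hC, ENNReal.mul_ne_top enorm_ne_top
      (ENNReal.mul_ne_top enorm_ne_top ENNReal.ofReal_ne_top)⟩) ?_ hζ (by simp [hqζ])
  · have hF2 : MemLp (fun x : ℝ => F x) 2 := by
      have h1 : MemLp (fun x : ℝ => F (x + (0 : ℝ) * Complex.I)) 2 :=
        ⟨(hFl 0 le_rfl).aestronglyMeasurable, (hb 0 le_rfl).trans_lt hC.lt_top⟩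
      simpa using h1
    have hq2 : MemLp (fun x : ℝ => q x) 2 := (memLp_inv_ofReal_sub (by linarith)).const_mul _
    have hk : MemLp (fun x : ℝ => ((x : ℂ) - ζ)⁻¹) 2 := memLp_inv_ofReal_sub hη.ne'
    have hFi : Integrable fun x : ℝ => F x * ((x : ℂ) - ζ)⁻¹ := hF2.integrable_mul hk
    have hqi : Integrable fun x : ℝ => q x * ((x : ℂ) - ζ)⁻¹ := hq2.integrable_mul hk
    have hqv : ∫ x : ℝ, q x * ((x : ℂ) - ζ)⁻¹ = 2 * Real.pi * Complex.I := by
      have h1 : ∀ x : ℝ, q x * ((x : ℂ) - ζ)⁻¹ =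
          (2 * ζ.im * Complex.I) * ((((x - ζ.re) ^ 2 + ζ.im ^ 2)⁻¹ : ℝ) : ℂ) := by
        intro x
        have h2 : ((x : ℂ) - b) * ((x : ℂ) - ζ) = (((x - ζ.re) ^ 2 + ζ.im ^ 2 : ℝ) : ℂ) := by
          apply Complex.ext <;> simp [hbdef, pow_two]
          ring
        have h3 : ζ - b = 2 * ζ.im * Complex.I := by
          apply Complex.ext <;> simp [hbdef]
          ring
        rw [Complex.ofReal_inv, ← h2, mul_inv, ← h3]
        simp only [hq]
        ring
      simp_rw [h1]
      rw [integral_const_mul, integral_complex_ofReal, integral_inv_sub_sq_add_sq _ hη.ne',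
        abs_of_pos hη]
      have : (ζ.im : ℂ) ≠ 0 := by exact_mod_cast hη.ne'
      push_cast
      field_simp
    have hsplit : ∫ x : ℝ, (F x - F ζ * q x) * ((x : ℂ) - ζ)⁻¹ =
        (∫ x : ℝ, F x * ((x : ℂ) - ζ)⁻¹) - F ζ * ∫ x : ℝ, q x * ((x : ℂ) - ζ)⁻¹ := by
      rw [← integral_const_mul, ← integral_sub hFi (hqi.const_mul _)]
      refine integral_congr_ae (ae_of_all _ fun x => ?_)
      simp only
      ring
    rw [hsplit, hqv] at hzero
    have h3 : ∫ x : ℝ, (starRingEnd ℂ) (fnP ζ x) * F x =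
        -Complex.I * ∫ x : ℝ, F x * ((x : ℂ) - ζ)⁻¹ := by
      rw [← integral_const_mul]
      refine integral_congr_ae (ae_of_all _ fun x => ?_)
      simp only [conj_fnP]
      ring
    rw [h3]
    linear_combination (-Complex.I) * hzero - 2 * Real.pi * F ζ * Complex.I_mul_I
  · intro y hy
    refine (eLpNorm_sub_le (hFl y hy).aestronglyMeasurable
      ((hql y hy).aestronglyMeasurable.const_mul _) (by norm_num)).trans ?_
    gcongr
    · exact hb y hy
    · rw [eLpNorm_const_mul]
      gcongr
      exact hqb y hy

/-! ### The Hardy space: boundary data and the Cauchy formula. -/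

theorem MemHardy.exists_bound {f : ℂ → ℂ} (hf : MemHardy f) : ∃ C : ℝ≥0∞, C ≠ ∞ ∧
    ∀ y : ℝ, 0 < y → eLpNorm (fun x : ℝ => f (x + y * Complex.I)) 2 ≤ C :=
  ⟨_, hf.2.ne, fun y hy => le_iSup₂ (f := fun (y : ℝ) (_ : 0 < y) =>
    eLpNorm (fun x : ℝ => f (x + y * Complex.I)) 2 (volume : Measure ℝ)) y hy⟩

theorem memHardy_of_bound {f : ℂ → ℂ} (hd : DifferentiableOn ℂ f upperHalf) {C : ℝ≥0∞}
    (hC : C ≠ ∞) (hb : ∀ y : ℝ, 0 < y → eLpNorm (fun x : ℝ => f (x + y * Complex.I)) 2 ≤ C) :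
    MemHardy f :=
  ⟨hd, (iSup₂_le hb).trans_lt hC.lt_top⟩

theorem MemHardy.continuous_line {f : ℂ → ℂ} (hf : MemHardy f) {y : ℝ} (hy : 0 < y) :
    Continuous fun x : ℝ => f (x + y * Complex.I) :=
  continuous_line_of_continuousOn hf.1.continuousOn fun x => by simpa [upperHalf] using hy

theorem MemHardy.memLp_line {f : ℂ → ℂ} (hf : MemHardy f) {y : ℝ} (hy : 0 < y) :
    MemLp (fun x : ℝ => f (x + y * Complex.I)) 2 := by
  obtain ⟨C, hC, hb⟩ := hf.exists_bound
  exact ⟨(hf.continuous_line hy).aestronglyMeasurable, (hb y hy).trans_lt hC.lt_top⟩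

/-- The inner product of `f(· + is)` and `f(· + iy)` in `L²(ℝ)` depends only on `y + s`. -/
theorem MemHardy.integral_line_mul_conj_shift {f : ℂ → ℂ} (hf : MemHardy f) {y s t : ℝ}
    (hy : 0 < y) (ht : 0 ≤ t) (hts : t < s) :
    ∫ x : ℝ, f (x + y * Complex.I) * (starRingEnd ℂ) (f (x + s * Complex.I)) =
      ∫ x : ℝ, f (x + (y + t : ℝ) * Complex.I) *
        (starRingEnd ℂ) (f (x + (s - t : ℝ) * Complex.I)) := by
  obtain ⟨C, hC, hb⟩ := hf.exists_bound
  -- Conjugating both argument and value makes the second factor holomorphic in `w`. On the line of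
  -- height `v` the two factors sit at heights `y + v` and `s - v`, whose sum is constant.
  set h : ℂ → ℂ := fun w => f (w + y * Complex.I) *
    (starRingEnd ℂ) (f ((starRingEnd ℂ) (w + -(s * Complex.I)))) with hh
  have hline : ∀ v x : ℝ, h (x + v * Complex.I) = f (x + (y + v : ℝ) * Complex.I) *
      (starRingEnd ℂ) (f (x + (s - v : ℝ) * Complex.I)) := by
    intro v x
    simp only [hh]
    congr 2
    · push_cast; ring
    · congr 1
      simp
      ring
  have hdiff : DifferentiableOn ℂ h (Complex.im ⁻¹' Ioo (-y) s) := by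
    intro w hw
    refine DifferentiableAt.differentiableWithinAt ?_
    have h1 : DifferentiableAt ℂ f (w + y * Complex.I) := by
      refine hf.1.differentiableAt (isOpen_upperHalf.mem_nhds ?_)
      have := hw.1
      simp [upperHalf]
      linarith
    have h2 : DifferentiableAt ℂ f ((starRingEnd ℂ) (w + -(s * Complex.I))) := by
      refine hf.1.differentiableAt (isOpen_upperHalf.mem_nhds ?_)
      have := hw.2
      simp [upperHalf]
      linarith
    have h3 := h2.conj_conj
    rw [Complex.conj_conj] at h3
    have h4 : DifferentiableAt ℂ (fun w => (starRingEnd ℂ) (f ((starRingEnd ℂ)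
        (w + -(s * Complex.I))))) w :=
      DifferentiableAt.comp (f := fun w => w + -(s * Complex.I)) w h3
        (differentiableAt_id.add_const _)
    exact (DifferentiableAt.comp (f := fun w => w + y * Complex.I) w h1
      (differentiableAt_id.add_const _)).mul h4
  have hbd : ∀ v ∈ Icc (0 : ℝ) t, eLpNorm (fun x : ℝ => h (x + v * Complex.I)) 1 ≤ C * C := by
    intro v hv
    have hyv : 0 < y + v := by linarith [hv.1]
    have hsv : 0 < s - v := by linarith [hv.2]
    simp_rw [hline]
    refine (eLpNorm_one_mul_le (hf.continuous_line hyv).aestronglyMeasurable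
      (Complex.continuous_conj.comp (hf.continuous_line hsv)).aestronglyMeasurable).trans ?_
    refine mul_le_mul' (hb _ hyv) (le_trans (eLpNorm_mono fun x => ?_) (hb _ hsv))
    simp
  have hinteg : ∀ v ∈ Icc (0 : ℝ) t, Integrable (fun x : ℝ => h (x + v * Complex.I)) := by
    intro v hv
    rw [← memLp_one_iff_integrable]
    refine ⟨Continuous.aestronglyMeasurable ?_,
      (hbd v hv).trans_lt (ENNReal.mul_lt_top hC.lt_top hC.lt_top)⟩
    refine continuous_line_of_continuousOn hdiff.continuousOn fun x => ?_
    simpa using ⟨by linarith [hv.1], by linarith [hv.2]⟩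
  have key := integral_line_eq_of_strip ht
    (hdiff.continuousOn.mono fun w hw => ⟨by linarith [hw.1], by linarith [hw.2]⟩)
    (hdiff.mono fun w hw => ⟨by linarith [hw.1], by linarith [hw.2]⟩)
    (hinteg 0 ⟨le_rfl, ht⟩) (hinteg t ⟨ht, le_rfl⟩) 0 (C * C) (ENNReal.mul_ne_top hC hC)
    fun v hv => (eLpNorm_mono_measure _ Measure.restrict_le_self).trans (hbd v hv)
  simp_rw [hline] at key
  simpa using key

/-- A midpoint convex function on `(0, ∞)` which is bounded above is nonincreasing. -/
theorem antitoneOn_of_midpoint_convex {N : ℝ → ℝ} {B : ℝ} (hB : ∀ y, 0 < y → N y ≤ B)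
    (hN : ∀ y s, 0 < y → 0 < s → 2 * N ((y + s) / 2) ≤ N y + N s) : AntitoneOn N (Ioi 0) := by
  intro y hy s _ hys
  by_contra! hlt
  have hy' : 0 < y := hy
  set d := s - y with hd
  have hd0 : 0 ≤ d := sub_nonneg.mpr hys
  have hpos : ∀ n : ℕ, 0 < y + n * d := fun n => by positivity
  -- Midpoint convexity makes the increments along an arithmetic progression nondecreasing, so one
  -- positive increment forces linear growth, against the bound `B`.
  have hstep : ∀ n : ℕ, N s - N y ≤ N (y + (n + 1 : ℕ) * d) - N (y + n * d) := by
    intro n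
    induction n with
    | zero => simp [hd]
    | succ n ih =>
      have h := hN _ _ (hpos n) (hpos (n + 2))
      have hm : (y + n * d + (y + (n + 2 : ℕ) * d)) / 2 = y + (n + 1 : ℕ) * d := by
        push_cast; ring
      rw [hm] at h
      linarith
  have hgrow : ∀ n : ℕ, N y + n * (N s - N y) ≤ N (y + n * d) := by
    intro n
    induction n with
    | zero => simp
    | succ n ih =>
      have := hstep n
      push_cast at this ⊢
      linarith
  obtain ⟨n, hn⟩ := exists_nat_gt ((B - N y) / (N s - N y))
  have h1 := hgrow n
  have h2 := hB _ (hpos n)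
  rw [div_lt_iff₀ (by linarith)] at hn
  linarith

theorem inner_toLp_eq_integral {α : Type*} [MeasurableSpace α] {μ : Measure α} {f g : α → ℂ}
    (hf : MemLp f 2 μ) (hg : MemLp g 2 μ) :
    inner ℂ (hf.toLp f) (hg.toLp g) = ∫ x, (starRingEnd ℂ) (f x) * g x ∂μ := by
  rw [L2.inner_def]
  refine integral_congr_ae ?_
  filter_upwards [hf.coeFn_toLp, hg.coeFn_toLp] with x hx hx'
  rw [hx, hx', RCLike.inner_apply, mul_comm]

/-- Functions in `H²` have boundary data. -/
theorem MemHardy.exists_isBoundaryData {f : ℂ → ℂ} (hf : MemHardy f) :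
    ∃ g, IsBoundaryData f g := by
  classical
  obtain ⟨C, hC, hb⟩ := hf.exists_bound
  set P : ℝ → Lp ℂ 2 (volume : Measure ℝ) := fun y =>
    if hy : 0 < y then (hf.memLp_line hy).toLp _ else 0 with hP
  have hPpos : ∀ y (hy : 0 < y), P y = (hf.memLp_line hy).toLp _ := fun y hy => dif_pos hy
  have hinner : ∀ y s, 0 < y → 0 < s → inner ℂ (P s) (P y) =
      ∫ x : ℝ, f (x + y * Complex.I) * (starRingEnd ℂ) (f (x + s * Complex.I)) := by
    intro y s hy hs
    rw [hPpos y hy, hPpos s hs, inner_toLp_eq_integral]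
    simp_rw [mul_comm]
  have hmid' : ∀ y s, 0 < y → y ≤ s →
      inner ℂ (P s) (P y) = (‖P ((y + s) / 2)‖ : ℂ) ^ 2 := by
    intro y s hy hys
    have hm : 0 < (y + s) / 2 := by linarith
    -- The shift `(s - y) / 2` moves both slices to the midpoint height, so the inner product
    -- becomes a squared norm.
    have h := hf.integral_line_mul_conj_shift hy (t := (s - y) / 2) (s := s) (by linarith)
      (by linarith)
    rw [show y + (s - y) / 2 = (y + s) / 2 by ring, show s - (s - y) / 2 = (y + s) / 2 by ring] at h
    rw [hinner y s hy (hy.trans_le hys), h, ← hinner _ _ hm hm, inner_self_eq_norm_sq_to_K]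
    rfl
  have hmid : ∀ y s, 0 < y → 0 < s →
      RCLike.re (inner ℂ (P s) (P y)) = ‖P ((y + s) / 2)‖ ^ 2 := by
    intro y s hy hs
    have hre : ∀ r : ℝ, RCLike.re ((r : ℂ) ^ 2) = r ^ 2 := fun r => by
      rw [← Complex.ofReal_pow]; rfl
    rcases le_total y s with h | h
    · rw [hmid' y s hy h, hre]
    · rw [inner_re_symm, hmid' s y hs h, hre, add_comm]
  have hdist : ∀ y s, 0 < y → 0 < s → ‖P s - P y‖ ^ 2 =
      ‖P s‖ ^ 2 - 2 * ‖P ((y + s) / 2)‖ ^ 2 + ‖P y‖ ^ 2 := by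
    intro y s hy hs
    rw [norm_sub_sq (𝕜 := ℂ), hmid y s hy hs]
  have hbound : ∀ y, 0 < y → ‖P y‖ ^ 2 ≤ C.toReal ^ 2 := by
    intro y hy
    gcongr
    rw [hPpos y hy, Lp.norm_toLp]
    exact ENNReal.toReal_mono hC (hb y hy)
  have hanti : AntitoneOn (fun y => ‖P y‖ ^ 2) (Ioi 0) :=
    antitoneOn_of_midpoint_convex hbound fun y s hy hs => by
      have h1 := hdist y s hy hs
      have h2 := sq_nonneg ‖P s - P y‖
      linarith
  obtain ⟨l, hl⟩ : ∃ l, Tendsto (fun y => ‖P y‖ ^ 2) (𝓝[>] 0) (𝓝 l) := by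
    have h := MonotoneOn.tendsto_nhdsWithin_Ioo_right (f := fun y => -‖P y‖ ^ 2) (x := (0 : ℝ))
      (y := 1) ⟨1 / 2, by norm_num, by norm_num⟩
      (fun a ha b hb hab => neg_le_neg (hanti ha.1 hb.1 hab))
      ⟨-C.toReal ^ 2, by rintro _ ⟨y, hy, rfl⟩; exact neg_le_neg (hbound y hy.1)⟩
    exact ⟨_, by simpa using h.neg⟩
  have hcauchy : Cauchy (map P (𝓝[>] 0)) := by
    rw [cauchy_map_iff]
    refine ⟨inferInstance, tendsto_uniformity_iff_dist_tendsto_zero.2 ?_⟩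
    have hm : Tendsto (fun p : ℝ × ℝ => (p.1 + p.2) / 2) (𝓝[>] 0 ×ˢ 𝓝[>] 0) (𝓝[>] 0) := by
      refine tendsto_nhdsWithin_iff.2 ⟨?_, ?_⟩
      · have h1 : Tendsto (fun p : ℝ × ℝ => (p.1 + p.2) / 2) (𝓝 0 ×ˢ 𝓝 0) (𝓝 ((0 + 0) / 2)) :=
          (tendsto_fst.add tendsto_snd).div_const 2
        rw [add_zero, zero_div] at h1
        exact h1.mono_left (prod_mono nhdsWithin_le_nhds nhdsWithin_le_nhds)
      · filter_upwards [prod_mem_prod self_mem_nhdsWithin self_mem_nhdsWithin] with p hp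
        have h1 : 0 < p.1 := hp.1
        have h2 : 0 < p.2 := hp.2
        exact mem_Ioi.2 (by linarith)
    -- By `hdist` this is the squared distance of two slices. All three heights tend to `0` from
    -- above, so it tends to `l - 2 * l + l = 0`.
    have h2 : Tendsto (fun p : ℝ × ℝ => ‖P p.1‖ ^ 2 - 2 * ‖P ((p.1 + p.2) / 2)‖ ^ 2 + ‖P p.2‖ ^ 2)
        (𝓝[>] 0 ×ˢ 𝓝[>] 0) (𝓝 (l - 2 * l + l)) :=
      ((hl.comp tendsto_fst).sub ((hl.comp hm).const_mul 2)).add (hl.comp tendsto_snd)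
    have h3 : Tendsto (fun p : ℝ × ℝ => √(‖P p.1‖ ^ 2 - 2 * ‖P ((p.1 + p.2) / 2)‖ ^ 2 +
        ‖P p.2‖ ^ 2)) (𝓝[>] 0 ×ˢ 𝓝[>] 0) (𝓝 0) := by
      have h4 := h2.sqrt
      rwa [show l - 2 * l + l = 0 by ring, Real.sqrt_zero] at h4
    refine h3.congr' ?_
    filter_upwards [prod_mem_prod self_mem_nhdsWithin self_mem_nhdsWithin] with p hp
    rw [add_comm p.1 p.2, ← hdist p.2 p.1 hp.2 hp.1, Real.sqrt_sq (norm_nonneg _), dist_eq_norm]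
  obtain ⟨g, hg⟩ := cauchy_map_iff_exists_tendsto.1 hcauchy
  refine ⟨g, Lp.memLp g, ?_⟩
  refine ((Lp.tendsto_Lp_iff_tendsto_eLpNorm' _ _).1 hg).congr' ?_
  filter_upwards [self_mem_nhdsWithin] with y hy
  refine eLpNorm_congr_ae ?_
  rw [hPpos y hy]
  filter_upwards [(hf.memLp_line hy).coeFn_toLp] with x hx
  rw [Pi.sub_apply, hx]

theorem fnP_memLp {ζ : ℂ} (hζ : ζ ∈ upperHalf) : MemLp (fun x : ℝ => fnP ζ x) 2 := by
  have h := (memLp_inv_ofReal_sub (b := (starRingEnd ℂ) ζ)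
    (by simpa using (ne_of_gt hζ : ζ.im ≠ 0))).const_mul Complex.I
  exact h

/-- The Cauchy formula: functions in `H²` are reproduced by the kernels `p_ζ` from their boundary
data. -/
theorem MemHardy.cauchy_formula {f : ℂ → ℂ} (hf : MemHardy f) {g : ℝ → ℂ}
    (hg : IsBoundaryData f g) {ζ : ℂ} (hζ : ζ ∈ upperHalf) :
    ∫ x : ℝ, (starRingEnd ℂ) (fnP ζ x) * g x = 2 * Real.pi * f ζ := by
  have hη : 0 < ζ.im := hζ
  obtain ⟨C, hC, hb⟩ := hf.exists_bound
  -- The translate `f(· + iy)` is continuous up to the real line, so the earlier formula applies;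
  -- then `y ↓ 0`.
  have hshift : ∀ y : ℝ, 0 < y →
      ∫ x : ℝ, (starRingEnd ℂ) (fnP ζ x) * f (x + y * Complex.I) =
        2 * Real.pi * f (ζ + y * Complex.I) := by
    intro y hy
    have hd : DifferentiableOn ℂ (fun w => f (w + y * Complex.I)) {w | -y < w.im} :=
      hf.1.comp (differentiableOn_id.add_const _) fun w (hw : -y < w.im) => by
        simp [upperHalf]; linarith
    refine cauchy_formula_of_continuousOn (F := fun w => f (w + y * Complex.I))
      (hd.continuousOn.mono fun w (hw : 0 ≤ w.im) => ?_)
      (hd.mono fun w (hw : 0 < w.im) => ?_) hC (fun v hv => ?_) hζ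
    · exact (by linarith : -y < w.im)
    · exact (by linarith : -y < w.im)
    · have h1 : ∀ x : ℝ, (x : ℂ) + v * Complex.I + y * Complex.I =
          x + (v + y : ℝ) * Complex.I := fun x => by push_cast; ring
      simp_rw [h1]
      exact hb _ (by linarith)
  have hlim1 : Tendsto (fun y : ℝ => 2 * Real.pi * f (ζ + y * Complex.I)) (𝓝[>] 0)
      (𝓝 (2 * Real.pi * f ζ)) := by
    have h1 : Tendsto (fun y : ℝ => ζ + y * Complex.I) (𝓝[>] 0) (𝓝 ζ) := by
      have : Continuous fun y : ℝ => ζ + y * Complex.I := by fun_prop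
      have h2 := this.tendsto 0
      simp only [Complex.ofReal_zero, zero_mul, add_zero] at h2
      exact h2.mono_left nhdsWithin_le_nhds
    exact ((hf.1.continuousOn.continuousAt (isOpen_upperHalf.mem_nhds hζ)).tendsto.comp
      h1).const_mul _
  have hk : MemLp (fun x : ℝ => (starRingEnd ℂ) (fnP ζ x)) 2 := (fnP_memLp hζ).star
  have hlim2 : Tendsto (fun y : ℝ => ∫ x : ℝ, (starRingEnd ℂ) (fnP ζ x) * f (x + y * Complex.I))
      (𝓝[>] 0) (𝓝 (∫ x : ℝ, (starRingEnd ℂ) (fnP ζ x) * g x)) := by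
    rw [tendsto_iff_edist_tendsto_0]
    have hz : Tendsto (fun y : ℝ => eLpNorm (fun x : ℝ => (starRingEnd ℂ) (fnP ζ x)) 2 volume *
        eLpNorm (fun x : ℝ => f (x + y * Complex.I) - g x) 2 volume) (𝓝[>] 0) (𝓝 0) := by
      have h1 := ENNReal.Tendsto.const_mul hg.2 (Or.inr hk.eLpNorm_ne_top)
      rwa [mul_zero] at h1
    refine tendsto_of_tendsto_of_tendsto_of_le_of_le' tendsto_const_nhds hz
      (Eventually.of_forall fun _ => zero_le) ?_
    filter_upwards [self_mem_nhdsWithin] with y hy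
    have hy' : 0 < y := hy
    have hi1 : Integrable fun x : ℝ => (starRingEnd ℂ) (fnP ζ x) * f (x + y * Complex.I) :=
      hk.integrable_mul (hf.memLp_line hy')
    have hi2 : Integrable fun x : ℝ => (starRingEnd ℂ) (fnP ζ x) * g x := hk.integrable_mul hg.1
    rw [edist_eq_enorm_sub, ← integral_sub hi1 hi2]
    refine (enorm_integral_le_lintegral_enorm _).trans ?_
    rw [← eLpNorm_one_eq_lintegral_enorm]
    simp_rw [← mul_sub]
    exact eLpNorm_one_mul_le hk.aestronglyMeasurable
      ((hf.memLp_line hy').sub hg.1).aestronglyMeasurable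
  refine tendsto_nhds_unique hlim2 (hlim1.congr' ?_)
  filter_upwards [self_mem_nhdsWithin] with y hy using (hshift y hy).symm

/-- Convergence in `L²` implies convergence in measure, hence almost everywhere along a subsequence
of heights, where the limit must agree with the pointwise one. -/
theorem IsBoundaryData.ae_eq_of_tendsto {f : ℂ → ℂ} {g g' : ℝ → ℂ} (hf : MemHardy f)
    (hg : IsBoundaryData f g)
    (h : ∀ᵐ x : ℝ, Tendsto (fun y : ℝ => f (x + y * Complex.I)) (𝓝[>] 0) (𝓝 (g' x))) :
    g =ᵐ[volume] g' := by
  obtain ⟨y, -, hy, hlim⟩ := exists_seq_strictAnti_tendsto' (x := (0 : ℝ)) (y := 1) one_pos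
  have hlim' : Tendsto y atTop (𝓝[>] 0) :=
    tendsto_nhdsWithin_iff.2 ⟨hlim, Eventually.of_forall fun n => (hy n).1⟩
  have hmeas := tendstoInMeasure_of_tendsto_eLpNorm (p := 2) (μ := (volume : Measure ℝ))
    (f := fun n (x : ℝ) => f (x + y n * Complex.I)) (g := g) two_ne_zero
    (fun n => (hf.memLp_line (hy n).1).aestronglyMeasurable) hg.1.aestronglyMeasurable
    (hg.2.comp hlim')
  obtain ⟨ns, hns, hae⟩ := hmeas.exists_seq_tendsto_ae
  filter_upwards [hae, h] with x hx hx'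
  exact tendsto_nhds_unique hx (hx'.comp (hlim'.comp hns.tendsto_atTop))

theorem IsBoundaryData.ae_eq {f : ℂ → ℂ} {g g' : ℝ → ℂ} (hf : MemHardy f)
    (hg : IsBoundaryData f g) (hg' : IsBoundaryData f g') : g =ᵐ[volume] g' := by
  have h0 : Tendsto (fun y : ℝ => eLpNorm (fun x : ℝ => f (x + y * Complex.I) - g' x) 2 volume +
      eLpNorm (fun x : ℝ => f (x + y * Complex.I) - g x) 2 volume) (𝓝[>] 0) (𝓝 (0 + 0)) :=
    hg'.2.add hg.2
  have h1 : eLpNorm (g - g') 2 volume ≤ 0 := by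
    rw [add_zero] at h0
    refine ge_of_tendsto h0 ?_
    filter_upwards [self_mem_nhdsWithin] with y hy
    have hl := hf.memLp_line hy
    have h2 := eLpNorm_sub_le (hl.sub hg'.1).aestronglyMeasurable
      (hl.sub hg.1).aestronglyMeasurable (p := 2) (by norm_num)
    refine le_trans (le_of_eq ?_) h2
    congr 1
    ext x
    simp
  have h2 := (eLpNorm_eq_zero_iff (hg.1.sub hg'.1).aestronglyMeasurable two_ne_zero).1
    (le_antisymm h1 (zero_le))
  filter_upwards [h2] with x hx using sub_eq_zero.mp hx

theorem MemHardy.isBoundaryData_boundaryData {f : ℂ → ℂ} (hf : MemHardy f) :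
    IsBoundaryData f (boundaryData f) := by
  have h := hf.exists_isBoundaryData
  rw [boundaryData, dif_pos h]
  exact h.choose_spec

/-- If a function in `H²` is continuous up to the real line then its boundary data are its
restriction to the real line. -/
theorem MemHardy.boundaryData_ae_eq {f : ℂ → ℂ} (hf : MemHardy f)
    (hc : ContinuousOn f {w | 0 ≤ w.im}) : boundaryData f =ᵐ[volume] fun x : ℝ => f x := by
  refine hf.isBoundaryData_boundaryData.ae_eq_of_tendsto hf (ae_of_all _ fun x => ?_)
  have h1 : Tendsto (fun y : ℝ => (x : ℂ) + y * Complex.I) (𝓝[>] 0) (𝓝[{w | 0 ≤ w.im}] (x : ℂ)) := by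
    refine tendsto_nhdsWithin_iff.2 ⟨?_, ?_⟩
    · have : Continuous fun y : ℝ => (x : ℂ) + y * Complex.I := by fun_prop
      have h2 := this.tendsto 0
      simp only [Complex.ofReal_zero, zero_mul, add_zero] at h2
      exact h2.mono_left nhdsWithin_le_nhds
    · filter_upwards [self_mem_nhdsWithin] with y hy
      simpa using le_of_lt hy
  exact (hc x (by simp)).tendsto.comp h1

theorem MemHardy.const_mul {f : ℂ → ℂ} (hf : MemHardy f) (c : ℂ) :
    MemHardy fun ζ => c * f ζ := by
  obtain ⟨C, hC, hb⟩ := hf.exists_bound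
  refine memHardy_of_bound ((differentiableOn_const _).mul hf.1) (C := ‖c‖ₑ * C)
    (ENNReal.mul_ne_top enorm_ne_top hC) fun y hy => ?_
  rw [eLpNorm_const_mul]
  gcongr
  exact hb y hy

theorem MemHardy.sub {f g : ℂ → ℂ} (hf : MemHardy f) (hg : MemHardy g) :
    MemHardy fun ζ => f ζ - g ζ := by
  obtain ⟨C, hC, hb⟩ := hf.exists_bound
  obtain ⟨D, hD, hb'⟩ := hg.exists_bound
  refine memHardy_of_bound (hf.1.sub hg.1) (C := C + D) (ENNReal.add_ne_top.2 ⟨hC, hD⟩)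
    fun y hy => ?_
  exact (eLpNorm_sub_le (hf.memLp_line hy).aestronglyMeasurable
    (hg.memLp_line hy).aestronglyMeasurable (by norm_num)).trans (add_le_add (hb y hy) (hb' y hy))

theorem IsBoundaryData.const_mul {f : ℂ → ℂ} {g : ℝ → ℂ} (hg : IsBoundaryData f g) (c : ℂ) :
    IsBoundaryData (fun ζ => c * f ζ) fun x => c * g x := by
  refine ⟨hg.1.const_mul c, ?_⟩
  simp_rw [← mul_sub, eLpNorm_const_mul]
  have := ENNReal.Tendsto.const_mul hg.2 (Or.inr (enorm_ne_top (x := c)))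
  rwa [mul_zero] at this

/-! ### The operator `𝒦` and its adjoint. -/

/-- The denominator of the kernel of `𝒦` is bounded away from zero near the closed half-plane. -/
theorem half_le_norm_sub_conj {δ : ℝ} {ζ τ : ℂ} (hτ : δ ≤ τ.im) (hζ : -(δ / 2) ≤ ζ.im) :
    δ / 2 ≤ ‖ζ - (starRingEnd ℂ) τ‖ := by
  have h := (le_abs_self _).trans (Complex.abs_im_le_norm (ζ - (starRingEnd ℂ) τ))
  simp at h
  linarith

/-- Here `|ζ - τ̄| ≥ δ`, while `|Re ζ + i| ≤ |Re (ζ - τ̄)| + M + 1`, and `M + 1` is absorbed as `(M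
+ 1) / δ` times `|ζ - τ̄|`. One square integrable function of `Re ζ` thus dominates every kernel,
whatever `τ` and the height. -/
theorem norm_inv_sub_conj_le {δ M : ℝ} (hδ : 0 < δ) {ζ τ : ℂ} (hτ : δ ≤ τ.im ∧ ‖τ‖ ≤ M)
    (hζ : 0 ≤ ζ.im) :
    ‖(ζ - (starRingEnd ℂ) τ)⁻¹‖ ≤ (1 + (M + 1) / δ) * ‖((ζ.re : ℂ) - -Complex.I)⁻¹‖ := by
  have h1 : δ ≤ ‖ζ - (starRingEnd ℂ) τ‖ := by
    have h := (le_abs_self _).trans (Complex.abs_im_le_norm (ζ - (starRingEnd ℂ) τ))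
    simp at h
    linarith [hτ.1]
  have hM : 0 ≤ M := (norm_nonneg _).trans hτ.2
  have hpos : 0 < ‖(ζ.re : ℂ) - -Complex.I‖ := norm_pos_iff.mpr (ofReal_sub_ne_zero (by simp) _)
  have h2 : ‖(ζ.re : ℂ) - -Complex.I‖ ≤ (1 + (M + 1) / δ) * ‖ζ - (starRingEnd ℂ) τ‖ := by
    have he : (ζ.re : ℂ) - -Complex.I =
        ((ζ - (starRingEnd ℂ) τ).re : ℂ) + (τ.re : ℂ) + Complex.I := by simp
    have h3 : (M + 1) ≤ (M + 1) / δ * ‖ζ - (starRingEnd ℂ) τ‖ := by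
      rw [div_mul_eq_mul_div, le_div_iff₀ hδ]
      gcongr
    rw [he]
    refine norm_add₃_le.trans ?_
    rw [Complex.norm_real, Complex.norm_real, Complex.norm_I, Real.norm_eq_abs, Real.norm_eq_abs]
    have h4 := Complex.abs_re_le_norm (ζ - (starRingEnd ℂ) τ)
    have h5 := (Complex.abs_re_le_norm τ).trans hτ.2
    linarith
  rw [norm_inv, norm_inv, ← div_eq_mul_inv, inv_le_comm₀ (by linarith) (by positivity), inv_div,
    div_le_iff₀ (by positivity), mul_comm]
  exact h2

theorem measurable_inv_sub_conj (ζ : ℂ) : Measurable fun τ : ℂ => (ζ - (starRingEnd ℂ) τ)⁻¹ :=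
  (measurable_const.sub Complex.continuous_conj.measurable).inv

section Kernel

variable {σ : Measure ℂ} {δ M : ℝ}

/-- The poles `τ̄` lie at or below height `-δ`, so `𝒦w` is analytic slightly beyond the real line.
This is why its boundary data are its values on `ℝ`. -/
theorem differentiableOn_opK (hδ : 0 < δ) (hσ : ∀ᵐ τ ∂σ, δ ≤ τ.im ∧ ‖τ‖ ≤ M) {w : ℂ → ℂ}
    (hw : Integrable w σ) : DifferentiableOn ℂ (opK σ w) {ζ | -(δ / 2) < ζ.im} := by
  intro ζ hζ
  refine DifferentiableAt.differentiableWithinAt ?_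
  refine DifferentiableAt.const_mul ?_ _
  have hopen : IsOpen {ζ : ℂ | -(δ / 2) < ζ.im} := isOpen_lt continuous_const Complex.continuous_im
  have hm : ∀ ξ : ℂ, AEStronglyMeasurable
      (fun τ => Complex.I * w τ / (ξ - (starRingEnd ℂ) τ)) σ := fun ξ =>
    (hw.1.const_mul _).mul (measurable_inv_sub_conj ξ).aestronglyMeasurable
  refine (hasDerivAt_integral_of_dominated_loc_of_deriv_le
    (F' := fun ξ τ => -(Complex.I * w τ) / (ξ - (starRingEnd ℂ) τ) ^ 2)
    (bound := fun τ => ((δ / 2) ^ 2)⁻¹ * ‖w τ‖) (hopen.mem_nhds hζ)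
    (Eventually.of_forall hm) ?_ ?_ ?_ (hw.norm.const_mul _) ?_).2.differentiableAt
  · refine (hw.norm.const_mul (δ / 2)⁻¹).mono' (hm ζ) ?_
    filter_upwards [hσ] with τ hτ
    have h1 := half_le_norm_sub_conj hτ.1 (le_of_lt hζ)
    rw [norm_div, norm_mul, Complex.norm_I, one_mul, div_eq_inv_mul]
    gcongr
  · refine (hw.1.const_mul _).neg.mul (Measurable.aestronglyMeasurable ?_)
    exact ((measurable_const.sub Complex.continuous_conj.measurable).pow_const 2).inv
  · filter_upwards [hσ] with τ hτ ξ hξ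
    have h1 := half_le_norm_sub_conj hτ.1 (le_of_lt hξ)
    rw [norm_div, norm_neg, norm_mul, Complex.norm_I, one_mul, norm_pow, div_eq_inv_mul]
    gcongr
  · filter_upwards [hσ] with τ hτ ξ hξ
    have h1 := half_le_norm_sub_conj hτ.1 (le_of_lt hξ)
    have hne : ξ - (starRingEnd ℂ) τ ≠ 0 := norm_pos_iff.1 (by linarith)
    have h2 := (((hasDerivAt_id ξ).sub_const ((starRingEnd ℂ) τ)).inv hne).const_mul
      (Complex.I * w τ)
    simp only [div_eq_mul_inv] at h2 ⊢
    refine h2.congr_deriv ?_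
    simp

theorem continuousOn_opK (hδ : 0 < δ) (hσ : ∀ᵐ τ ∂σ, δ ≤ τ.im ∧ ‖τ‖ ≤ M) {w : ℂ → ℂ}
    (hw : Integrable w σ) : ContinuousOn (opK σ w) {ζ | 0 ≤ ζ.im} :=
  (differentiableOn_opK hδ hσ hw).continuousOn.mono fun ζ (hζ : 0 ≤ ζ.im) =>
    show -(δ / 2) < ζ.im by linarith

theorem norm_opK_le (hδ : 0 < δ) (hσ : ∀ᵐ τ ∂σ, δ ≤ τ.im ∧ ‖τ‖ ≤ M) {w : ℂ → ℂ}
    (hw : Integrable w σ) {ζ : ℂ} (hζ : 0 ≤ ζ.im) :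
    ‖opK σ w ζ‖ ≤ ‖((1 / (2 * Real.pi) * ((1 + (M + 1) / δ) * ∫ τ, ‖w τ‖ ∂σ) : ℝ) : ℂ) *
      ((ζ.re : ℂ) - -Complex.I)⁻¹‖ := by
  have h1 : ‖∫ τ, Complex.I * w τ / (ζ - (starRingEnd ℂ) τ) ∂σ‖ ≤
      (1 + (M + 1) / δ) * ‖((ζ.re : ℂ) - -Complex.I)⁻¹‖ * ∫ τ, ‖w τ‖ ∂σ := by
    rw [← integral_const_mul]
    refine norm_integral_le_of_norm_le (hw.norm.const_mul _) ?_
    filter_upwards [hσ] with τ hτ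
    rw [div_eq_mul_inv, norm_mul, norm_mul, Complex.norm_I, one_mul, mul_comm]
    gcongr
    exact norm_inv_sub_conj_le hδ hτ hζ
  have h2 : ‖(1 / (2 * Real.pi) : ℂ)‖ = 1 / (2 * Real.pi) := by
    have : (1 / (2 * Real.pi) : ℂ) = ((1 / (2 * Real.pi) : ℝ) : ℂ) := by push_cast; rfl
    rw [this, Complex.norm_real, Real.norm_of_nonneg (by positivity)]
  rw [opK, norm_mul, h2, norm_mul, Complex.norm_real]
  refine le_trans ?_ (mul_le_mul_of_nonneg_right (le_abs_self _) (norm_nonneg _))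
  rw [mul_assoc]
  gcongr
  exact h1.trans (le_of_eq (by ring))

theorem eLpNorm_opK_line_le (hδ : 0 < δ) (hσ : ∀ᵐ τ ∂σ, δ ≤ τ.im ∧ ‖τ‖ ≤ M) {w : ℂ → ℂ}
    (hw : Integrable w σ) {y : ℝ} (hy : 0 ≤ y) :
    eLpNorm (fun x : ℝ => opK σ w (x + y * Complex.I)) 2 ≤
      ‖((1 / (2 * Real.pi) * ((1 + (M + 1) / δ) * ∫ τ, ‖w τ‖ ∂σ) : ℝ) : ℂ)‖ₑ *
        eLpNorm (fun x : ℝ => ((x : ℂ) - -Complex.I)⁻¹) 2 := by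
  rw [← eLpNorm_const_mul]
  refine eLpNorm_mono fun x => ?_
  simpa using norm_opK_le hδ hσ hw (ζ := x + y * Complex.I) (by simpa using hy)

theorem memHardy_opK (hδ : 0 < δ) (hσ : ∀ᵐ τ ∂σ, δ ≤ τ.im ∧ ‖τ‖ ≤ M) {w : ℂ → ℂ}
    (hw : Integrable w σ) : MemHardy (opK σ w) :=
  memHardy_of_bound ((differentiableOn_opK hδ hσ hw).mono fun ζ (hζ : 0 < ζ.im) =>
    show -(δ / 2) < ζ.im by linarith)
    (ENNReal.mul_ne_top enorm_ne_top (memLp_inv_ofReal_sub (by simp)).eLpNorm_ne_top)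
    fun _ hy => eLpNorm_opK_line_le hδ hσ hw hy.le

theorem memLp_opK (hδ : 0 < δ) (hσ : ∀ᵐ τ ∂σ, δ ≤ τ.im ∧ ‖τ‖ ≤ M) {w : ℂ → ℂ}
    (hw : Integrable w σ) : MemLp (fun x : ℝ => opK σ w x) 2 := by
  refine ⟨((continuousOn_opK hδ hσ hw).comp_continuous (by fun_prop)
    fun x => by simp).aestronglyMeasurable, ?_⟩
  have h := eLpNorm_opK_line_le hδ hσ hw le_rfl
  simp only [Complex.ofReal_zero, zero_mul, add_zero] at h
  exact h.trans_lt (ENNReal.mul_lt_top enorm_lt_top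
    (memLp_inv_ofReal_sub (by simp)).eLpNorm_lt_top)

/-- The operator `𝒦` into `L²(ℝ)` is adjoint to the restriction of functions in `H²` to `σ`. -/
theorem integral_conj_opK_mul [SFinite σ] (hδ : 0 < δ) (hσ : ∀ᵐ τ ∂σ, δ ≤ τ.im ∧ ‖τ‖ ≤ M)
    {w : ℂ → ℂ} (hw : Integrable w σ) {f : ℂ → ℂ} (hf : MemHardy f) {g : ℝ → ℂ}
    (hg : IsBoundaryData f g) :
    ∫ x : ℝ, (starRingEnd ℂ) (opK σ w x) * g x = ∫ τ, (starRingEnd ℂ) (w τ) * f τ ∂σ := by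
  have hkm : Measurable fun p : ℝ × ℂ => (starRingEnd ℂ) (fnP p.2 p.1) := by
    unfold fnP
    exact Complex.continuous_conj.measurable.comp (measurable_const.div
      ((Complex.continuous_ofReal.measurable.comp measurable_fst).sub
        (Complex.continuous_conj.measurable.comp measurable_snd)))
  have hgi : Integrable fun x : ℝ => (1 + (M + 1) / δ) * (‖((x : ℂ) - -Complex.I)⁻¹‖ * ‖g x‖) :=
    ((memLp_inv_ofReal_sub (by simp)).norm.integrable_mul hg.1.norm).const_mul _
  have hinteg : Integrable (Function.uncurry fun (x : ℝ) (τ : ℂ) =>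
      (starRingEnd ℂ) (w τ) * ((starRingEnd ℂ) (fnP τ x) * g x)) (volume.prod σ) := by
    refine (hgi.mul_prod hw.norm).mono' ?_ ?_
    · exact (Complex.continuous_conj.comp_aestronglyMeasurable hw.1.comp_snd).mul
        (hkm.aestronglyMeasurable.mul hg.1.1.comp_fst)
    · have h2 : ∀ᵐ p : ℝ × ℂ ∂(volume.prod σ), δ ≤ p.2.im ∧ ‖p.2‖ ≤ M :=
        Measure.quasiMeasurePreserving_snd.ae hσ
      filter_upwards [h2] with p hp
      have h3 := norm_inv_sub_conj_le hδ hp (ζ := (p.1 : ℂ)) (by simp)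
      simp only [Complex.ofReal_re] at h3
      rw [Function.uncurry, norm_mul, norm_mul, RCLike.norm_conj, RCLike.norm_conj, fnP,
        div_eq_mul_inv, norm_mul, Complex.norm_I, one_mul, mul_comm]
      refine mul_le_mul_of_nonneg_right ?_ (norm_nonneg _)
      rw [← mul_assoc]
      gcongr
  have h1 : ∀ x : ℝ, (starRingEnd ℂ) (opK σ w x) * g x = (1 / (2 * Real.pi) : ℂ) *
      ∫ τ, (starRingEnd ℂ) (w τ) * ((starRingEnd ℂ) (fnP τ x) * g x) ∂σ := by
    intro x
    rw [opK, map_mul, ← integral_conj, mul_assoc, ← integral_mul_const]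
    congr 1
    · simp [Complex.conj_ofNat]
    · refine integral_congr_ae (ae_of_all _ fun τ => ?_)
      simp only [fnP, map_div₀, map_mul]
      ring
  simp_rw [h1]
  -- After the swap, the inner integral over `ℝ` is the Cauchy formula at `τ`, and its `2π` cancels
  -- the factor in `𝒦`.
  rw [integral_const_mul, integral_integral_swap hinteg, ← integral_const_mul]
  refine integral_congr_ae ?_
  filter_upwards [hσ] with τ hτ
  rw [integral_const_mul, hf.cauchy_formula hg (show 0 < τ.im by linarith [hτ.1])]
  have : (Real.pi : ℂ) ≠ 0 := by exact_mod_cast Real.pi_ne_zero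
  field_simp

theorem fnP_continuousOn {z : ℂ} (hz : z ∈ upperHalf) : ContinuousOn (fnP z) {ζ | 0 ≤ ζ.im} := by
  refine continuousOn_const.div (continuousOn_id.sub continuousOn_const)
    fun ζ (hζ : 0 ≤ ζ.im) he => ?_
  have h1 := congrArg Complex.im he
  have h2 : 0 < z.im := hz
  simp at h1
  linarith

theorem fnP_ne_zero {z ζ : ℂ} (hz : z ∈ upperHalf) (hζ : 0 ≤ ζ.im) : fnP z ζ ≠ 0 := by
  refine div_ne_zero Complex.I_ne_zero fun he => ?_
  have h1 := congrArg Complex.im he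
  have h2 : 0 < z.im := hz
  simp at h1
  linarith

theorem memHardy_fnP {z : ℂ} (hz : z ∈ upperHalf) : MemHardy (fnP z) := by
  have hz' : 0 < z.im := hz
  -- The kernel `p_z` is `2π 𝒦 1` for the unit point mass at `z`, so the bounds for `𝒦` cover it.
  have h := (memHardy_opK (σ := Measure.dirac z) (δ := z.im) (M := ‖z‖) hz' (by simp)
    (w := fun _ => 1) (integrable_const _)).const_mul (2 * Real.pi)
  have he : (fun ζ => 2 * Real.pi * opK (Measure.dirac z) (fun _ => 1) ζ) = fnP z := by
    ext ζ
    have : (Real.pi : ℂ) ≠ 0 := by exact_mod_cast Real.pi_ne_zero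
    rw [opK, integral_dirac, fnP]
    field_simp
  rwa [he] at h

end Kernel

/-! ### Norms and pairings in `L²`. -/

theorem normL2_congr {α : Type*} [MeasurableSpace α] {μ : Measure α} {f g : α → ℂ}
    (h : f =ᵐ[μ] g) : normL2 μ f = normL2 μ g := by
  rw [normL2, normL2, eLpNorm_congr_ae h]

theorem norm_integral_conj_mul_le {α : Type*} [MeasurableSpace α] {μ : Measure α} {f g : α → ℂ}
    (hf : MemLp f 2 μ) (hg : MemLp g 2 μ) :
    ‖∫ x, (starRingEnd ℂ) (f x) * g x ∂μ‖ ≤ normL2 μ f * normL2 μ g := by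
  rw [← inner_toLp_eq_integral hf hg]
  refine (norm_inner_le_norm _ _).trans (le_of_eq ?_)
  rw [Lp.norm_toLp, Lp.norm_toLp, normL2, normL2]

theorem integral_conj_mul_self {α : Type*} [MeasurableSpace α] {μ : Measure α} {f : α → ℂ}
    (hf : MemLp f 2 μ) : ∫ x, (starRingEnd ℂ) (f x) * f x ∂μ = ((normL2 μ f ^ 2 : ℝ) : ℂ) := by
  rw [← inner_toLp_eq_integral hf hf, inner_self_eq_norm_sq_to_K, Lp.norm_toLp, normL2]
  push_cast
  rfl

theorem ae_eq_zero_of_normL2_eq_zero {α : Type*} [MeasurableSpace α] {μ : Measure α} {f : α → ℂ}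
    (hf : MemLp f 2 μ) (h : normL2 μ f = 0) : f =ᵐ[μ] 0 := by
  have := (ENNReal.toReal_eq_zero_iff _).1 h
  exact (eLpNorm_eq_zero_iff hf.1 two_ne_zero).1 (this.resolve_right hf.eLpNorm_ne_top)

theorem normL2_mul_const {α : Type*} [MeasurableSpace α] {μ : Measure α} (f : α → ℂ) {m : ℝ}
    (hm : 0 ≤ m) : normL2 μ (fun x => f x * (m : ℂ)) = normL2 μ f * m := by
  simp_rw [mul_comm _ (m : ℂ)]
  rw [normL2, eLpNorm_const_mul, ENNReal.toReal_mul, normL2, mul_comm, toReal_enorm,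
    Complex.norm_real, Real.norm_of_nonneg hm]

theorem MemHardy.hardyNorm_eq {f : ℂ → ℂ} (hf : MemHardy f) {g : ℝ → ℂ}
    (hg : IsBoundaryData f g) : hardyNorm f = normL2 volume g :=
  normL2_congr (hf.isBoundaryData_boundaryData.ae_eq hf hg)

theorem MemHardy.isBoundaryData_of_continuousOn {f : ℂ → ℂ} (hf : MemHardy f)
    (hc : ContinuousOn f {w | 0 ≤ w.im}) : IsBoundaryData f fun x : ℝ => f x := by
  have h := hf.isBoundaryData_boundaryData
  have he := hf.boundaryData_ae_eq hc
  refine ⟨(memLp_congr_ae he).1 h.1, h.2.congr fun y => eLpNorm_congr_ae ?_⟩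
  filter_upwards [he] with x hx
  rw [hx]

/-! ### Solving the integral equation. -/

section Equation

variable {σ : Measure ℂ} {δ M : ℝ}

theorem MemHardy.memLp_of_compact [IsFiniteMeasure σ] (hδ : 0 < δ)
    (hσ : ∀ᵐ τ ∂σ, δ ≤ τ.im ∧ ‖τ‖ ≤ M) {f : ℂ → ℂ} (hf : MemHardy f) : MemLp f 2 σ := by
  have hcl : IsClosed {τ : ℂ | δ ≤ τ.im ∧ ‖τ‖ ≤ M} :=
    (isClosed_le continuous_const Complex.continuous_im).inter
      (isClosed_le continuous_norm continuous_const)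
  have hK : IsCompact {τ : ℂ | δ ≤ τ.im ∧ ‖τ‖ ≤ M} :=
    (isCompact_closedBall (0 : ℂ) M).of_isClosed_subset hcl fun τ hτ => by simpa using hτ.2
  have hc : ContinuousOn f {τ : ℂ | δ ≤ τ.im ∧ ‖τ‖ ≤ M} :=
    hf.1.continuousOn.mono fun τ hτ => hδ.trans_le hτ.1
  obtain ⟨B, hB⟩ := hK.exists_bound_of_continuousOn hc
  refine MemLp.of_bound ?_ B (hσ.mono fun τ hτ => hB τ hτ)
  rw [← Measure.restrict_eq_self_of_ae_mem hσ]
  exact hc.aestronglyMeasurable hcl.measurableSet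

theorem integrable_kernel (hδ : 0 < δ) (hσ : ∀ᵐ τ ∂σ, δ ≤ τ.im ∧ ‖τ‖ ≤ M) {w : ℂ → ℂ}
    (hw : Integrable w σ) {ζ : ℂ} (hζ : 0 ≤ ζ.im) :
    Integrable (fun τ => Complex.I * w τ / (ζ - (starRingEnd ℂ) τ)) σ := by
  refine (hw.norm.const_mul (δ / 2)⁻¹).mono'
    ((hw.1.const_mul _).mul (measurable_inv_sub_conj ζ).aestronglyMeasurable) ?_
  filter_upwards [hσ] with τ hτ
  have h1 := half_le_norm_sub_conj (ζ := ζ) hτ.1 (by linarith)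
  rw [norm_div, norm_mul, Complex.norm_I, one_mul, div_eq_inv_mul]
  gcongr

theorem opK_congr {w w' : ℂ → ℂ} (h : w =ᵐ[σ] w') : opK σ w = opK σ w' := by
  ext ζ
  rw [opK, opK]
  congr 1
  refine integral_congr_ae ?_
  filter_upwards [h] with τ hτ
  rw [hτ]

theorem opK_zero (ζ : ℂ) : opK σ 0 ζ = 0 := by simp [opK]

theorem opK_add (hδ : 0 < δ) (hσ : ∀ᵐ τ ∂σ, δ ≤ τ.im ∧ ‖τ‖ ≤ M) {w w' : ℂ → ℂ}
    (hw : Integrable w σ) (hw' : Integrable w' σ) {ζ : ℂ} (hζ : 0 ≤ ζ.im) :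
    opK σ (w + w') ζ = opK σ w ζ + opK σ w' ζ := by
  rw [opK, opK, opK, ← mul_add,
    ← integral_add (integrable_kernel hδ hσ hw hζ) (integrable_kernel hδ hσ hw' hζ)]
  congr 2
  ext τ
  simp only [Pi.add_apply]
  ring

theorem opK_smul (c : ℂ) (w : ℂ → ℂ) (ζ : ℂ) : opK σ (c • w) ζ = c * opK σ w ζ := by
  rw [opK, opK, mul_left_comm]
  congr 1
  rw [← integral_const_mul]
  refine integral_congr_ae (ae_of_all _ fun τ => ?_)
  simp only [Pi.smul_apply, smul_eq_mul]
  ring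

theorem integrable_coeFn_Lp [IsFiniteMeasure σ] (w : Lp ℂ 2 σ) : Integrable w σ :=
  (Lp.memLp w).integrable (by norm_num)

theorem integral_norm_coeFn_Lp_le [IsFiniteMeasure σ] (w : Lp ℂ 2 σ) :
    ∫ τ, ‖w τ‖ ∂σ ≤ ‖w‖ * (σ univ ^ (1 / (1 : ℝ≥0∞).toReal - 1 / (2 : ℝ≥0∞).toReal)).toReal := by
  rw [integral_norm_eq_lintegral_enorm (Lp.aestronglyMeasurable w),
    ← eLpNorm_one_eq_lintegral_enorm, Lp.norm_def, ← ENNReal.toReal_mul]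
  refine ENNReal.toReal_mono (ENNReal.mul_ne_top (Lp.eLpNorm_ne_top w) ?_)
    (eLpNorm_le_eLpNorm_mul_rpow_measure_univ (by norm_num) (Lp.aestronglyMeasurable w))
  exact ENNReal.rpow_ne_top_of_nonneg (by norm_num) (measure_ne_top _ _)

/-- `𝒦` as a bounded operator from `L²(σ)` to `L²(ℝ)`. -/
theorem exists_opK_continuousLinearMap [IsFiniteMeasure σ] (hδ : 0 < δ)
    (hσ : ∀ᵐ τ ∂σ, δ ≤ τ.im ∧ ‖τ‖ ≤ M) :
    ∃ S : Lp ℂ 2 σ →L[ℂ] Lp ℂ 2 (volume : Measure ℝ),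
      ∀ w : Lp ℂ 2 σ, S w = (memLp_opK hδ hσ (integrable_coeFn_Lp w)).toLp := by
  let T : Lp ℂ 2 σ →ₗ[ℂ] Lp ℂ 2 (volume : Measure ℝ) :=
    { toFun := fun w => (memLp_opK hδ hσ (integrable_coeFn_Lp w)).toLp
      map_add' := fun v w => by
        rw [← MemLp.toLp_add, MemLp.toLp_eq_toLp_iff]
        refine ae_of_all _ fun x => ?_
        simp only [Pi.add_apply]
        rw [opK_congr (Lp.coeFn_add v w), opK_add hδ hσ (integrable_coeFn_Lp v)
          (integrable_coeFn_Lp w) (by simp)]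
      map_smul' := fun c w => by
        rw [RingHom.id_apply, ← MemLp.toLp_const_smul, MemLp.toLp_eq_toLp_iff]
        refine ae_of_all _ fun x => ?_
        simp only [Pi.smul_apply, smul_eq_mul]
        rw [opK_congr (Lp.coeFn_smul c w), opK_smul] }
  set D := (σ univ ^ (1 / (1 : ℝ≥0∞).toReal - 1 / (2 : ℝ≥0∞).toReal)).toReal
  set A : ℝ := 1 / (2 * Real.pi) * (1 + (M + 1) / δ)
  set N := (eLpNorm (fun x : ℝ => ((x : ℂ) - -Complex.I)⁻¹) 2 volume).toReal
  refine ⟨T.mkContinuous (|A| * D * N) fun w => ?_, fun w => rfl⟩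
  have h := eLpNorm_opK_line_le hδ hσ (integrable_coeFn_Lp w) le_rfl
  simp only [Complex.ofReal_zero, zero_mul, add_zero] at h
  have h' := ENNReal.toReal_mono (ENNReal.mul_ne_top enorm_ne_top
    (memLp_inv_ofReal_sub (by simp)).eLpNorm_ne_top) h
  rw [ENNReal.toReal_mul, toReal_enorm, Complex.norm_real, ← mul_assoc, norm_mul,
    Real.norm_eq_abs, Real.norm_of_nonneg (integral_nonneg fun _ => norm_nonneg _)] at h'
  calc ‖T w‖ = (eLpNorm (fun x : ℝ => opK σ w x) 2 volume).toReal :=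
        Lp.norm_toLp _ (memLp_opK hδ hσ (integrable_coeFn_Lp w))
    _ ≤ |A| * (∫ τ, ‖w τ‖ ∂σ) * N := h'
    _ ≤ |A| * (‖w‖ * D) * N := by
        gcongr
        exact integral_norm_coeFn_Lp_le w
    _ = |A| * D * N * ‖w‖ := by ring

/-- `𝒦 + ε²` is an invertible operator on `L²(σ)`. -/
theorem exists_isUnit_opK_add [IsFiniteMeasure σ] (hδ : 0 < δ)
    (hσ : ∀ᵐ τ ∂σ, δ ≤ τ.im ∧ ‖τ‖ ≤ M) {ε : ℝ} (hε : 0 < ε) :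
    ∃ A : Lp ℂ 2 σ →L[ℂ] Lp ℂ 2 σ, IsUnit A ∧
      ∀ w : Lp ℂ 2 σ, A w =ᵐ[σ] fun ζ => opK σ w ζ + (ε : ℂ) ^ 2 * w ζ := by
  obtain ⟨S, hS⟩ := exists_opK_continuousLinearMap hδ hσ
  -- The operator `S* S` is `𝒦` followed by restriction to `σ`: test against `v` and use the adjoint
  -- relation with `f = 𝒦w`.
  have hSS : ∀ w : Lp ℂ 2 σ, (S.adjoint ∘L S) w =
      ((memHardy_opK hδ hσ (integrable_coeFn_Lp w)).memLp_of_compact hδ hσ).toLp := by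
    intro w
    have hH := memHardy_opK hδ hσ (integrable_coeFn_Lp w)
    refine ext_inner_left ℂ fun v => ?_
    rw [ContinuousLinearMap.comp_apply, ContinuousLinearMap.adjoint_inner_right, hS, hS,
      inner_toLp_eq_integral, integral_conj_opK_mul hδ hσ (integrable_coeFn_Lp v) hH
        (hH.isBoundaryData_of_continuousOn (continuousOn_opK hδ hσ (integrable_coeFn_Lp w))),
      ← inner_toLp_eq_integral (Lp.memLp v) (hH.memLp_of_compact hδ hσ), Lp.toLp_coeFn]
  refine ⟨S.adjoint ∘L S + (ε : ℂ) ^ 2 • ContinuousLinearMap.id ℂ _, ?_, fun w => ?_⟩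
  -- Lax-Milgram: the quadratic form equals `‖S x‖² + ε² ‖x‖²`, which is coercive with constant
  -- `ε²`.
  · refine ContinuousLinearMap.isUnit_of_forall_le_norm_inner_map _
      (c := ⟨ε ^ 2, by positivity⟩) (by exact_mod_cast (by positivity : 0 < ε ^ 2)) fun x => ?_
    have h1 : inner ℂ ((S.adjoint ∘L S + (ε : ℂ) ^ 2 • ContinuousLinearMap.id ℂ (Lp ℂ 2 σ)) x) x =
        ((‖S x‖ ^ 2 + ε ^ 2 * ‖x‖ ^ 2 : ℝ) : ℂ) := by
      rw [add_apply, inner_add_left, ContinuousLinearMap.comp_apply,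
        ContinuousLinearMap.adjoint_inner_left, smul_apply,
        ContinuousLinearMap.id_apply, inner_smul_left, inner_self_eq_norm_sq_to_K,
        inner_self_eq_norm_sq_to_K]
      simp
    rw [h1, Complex.norm_real, Real.norm_of_nonneg (by positivity)]
    change ‖x‖ ^ 2 * ε ^ 2 ≤ _
    nlinarith [sq_nonneg ‖S x‖]
  · rw [add_apply, hSS, smul_apply,
      ContinuousLinearMap.id_apply]
    filter_upwards [Lp.coeFn_add (((memHardy_opK hδ hσ
      (integrable_coeFn_Lp w)).memLp_of_compact hδ hσ).toLp) ((ε : ℂ) ^ 2 • w),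
      Lp.coeFn_smul ((ε : ℂ) ^ 2) w, ((memHardy_opK hδ hσ
      (integrable_coeFn_Lp w)).memLp_of_compact hδ hσ).coeFn_toLp] with ζ h1 h2 h3
    rw [h1, Pi.add_apply, h2, h3, Pi.smul_apply, smul_eq_mul]

theorem exists_isSolution [IsFiniteMeasure σ] (hδ : 0 < δ)
    (hσ : ∀ᵐ τ ∂σ, δ ≤ τ.im ∧ ‖τ‖ ≤ M) {ε : ℝ} (hε : 0 < ε) {z : ℂ} (hz : z ∈ upperHalf) :
    ∃ w, IsSolution σ ε z w := by
  obtain ⟨A, ⟨U, rfl⟩, hA⟩ := exists_isUnit_opK_add hδ hσ hε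
  have hp := (memHardy_fnP hz).memLp_of_compact hδ hσ
  refine ⟨((U⁻¹ : _ˣ) : Lp ℂ 2 σ →L[ℂ] Lp ℂ 2 σ) (hp.toLp _), Lp.memLp _, ?_⟩
  have h1 : (U : Lp ℂ 2 σ →L[ℂ] Lp ℂ 2 σ) (((U⁻¹ : _ˣ) : Lp ℂ 2 σ →L[ℂ] Lp ℂ 2 σ) (hp.toLp _)) =
      hp.toLp _ := by
    rw [← mul_apply_eq_comp, Units.mul_inv, one_apply_eq_self]
  have h2 := hA (((U⁻¹ : _ˣ) : Lp ℂ 2 σ →L[ℂ] Lp ℂ 2 σ) (hp.toLp _))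
  rw [h1] at h2
  filter_upwards [h2, hp.coeFn_toLp] with ζ h3 h4
  rw [← h3, h4]

theorem IsSolution.ae_eq [IsFiniteMeasure σ] (hδ : 0 < δ)
    (hσ : ∀ᵐ τ ∂σ, δ ≤ τ.im ∧ ‖τ‖ ≤ M) {ε : ℝ} (hε : 0 < ε) {z : ℂ} {w₁ w₂ : ℂ → ℂ}
    (h₁ : IsSolution σ ε z w₁) (h₂ : IsSolution σ ε z w₂) : w₁ =ᵐ[σ] w₂ := by
  obtain ⟨A, ⟨U, rfl⟩, hA⟩ := exists_isUnit_opK_add hδ hσ hε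
  have key : ∀ w (h : IsSolution σ ε z w),
      (U : Lp ℂ 2 σ →L[ℂ] Lp ℂ 2 σ) (h.1.toLp w) =ᵐ[σ] fnP z := by
    intro w h
    have hA' := hA (h.1.toLp w)
    rw [opK_congr h.1.coeFn_toLp] at hA'
    filter_upwards [hA', h.1.coeFn_toLp, h.2] with ζ e1 e2 e3
    rw [e1, e2, e3]
  have he : (U : Lp ℂ 2 σ →L[ℂ] Lp ℂ 2 σ) (h₁.1.toLp w₁) =
      (U : Lp ℂ 2 σ →L[ℂ] Lp ℂ 2 σ) (h₂.1.toLp w₂) :=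
    Lp.ext ((key w₁ h₁).trans (key w₂ h₂).symm)
  have he' := congrArg ((U⁻¹ : _ˣ) : Lp ℂ 2 σ →L[ℂ] Lp ℂ 2 σ) he
  rw [← mul_apply_eq_comp, ← mul_apply_eq_comp, Units.inv_mul,
    one_apply_eq_self, one_apply_eq_self] at he'
  exact (MemLp.toLp_eq_toLp_iff _ _).1 he'

theorem IsSolution.extendSol_ae_eq {ε : ℝ} (hε : 0 < ε) {z : ℂ} {w : ℂ → ℂ}
    (h : IsSolution σ ε z w) : extendSol σ ε z w =ᵐ[σ] w := by
  filter_upwards [h.2] with ζ hζ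
  have : (ε : ℂ) ≠ 0 := by exact_mod_cast hε.ne'
  rw [extendSol, ← hζ]
  field_simp
  ring

theorem memHardy_extendSol (hδ : 0 < δ) (hσ : ∀ᵐ τ ∂σ, δ ≤ τ.im ∧ ‖τ‖ ≤ M) {ε : ℝ} {z : ℂ}
    (hz : z ∈ upperHalf) {w : ℂ → ℂ} (hw : Integrable w σ) : MemHardy (extendSol σ ε z w) := by
  have h := ((memHardy_fnP hz).sub (memHardy_opK hδ hσ hw)).const_mul ((ε : ℂ) ^ 2)⁻¹
  simp_rw [← div_eq_inv_mul] at h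
  exact h

theorem isBoundaryData_extendSol (hδ : 0 < δ) (hσ : ∀ᵐ τ ∂σ, δ ≤ τ.im ∧ ‖τ‖ ≤ M) {ε : ℝ} {z : ℂ}
    (hz : z ∈ upperHalf) {w : ℂ → ℂ} (hw : Integrable w σ) :
    IsBoundaryData (extendSol σ ε z w) fun x : ℝ => extendSol σ ε z w x :=
  (memHardy_extendSol hδ hσ hz hw).isBoundaryData_of_continuousOn
    (((fnP_continuousOn hz).sub (continuousOn_opK hδ hσ hw)).div_const _)

/-- The extended solution represents evaluation at `z` with respect to the inner product
`(f, g)_{L²(σ)} + ε² (f, g)_{H²}`. -/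
theorem integral_extendSol [SFinite σ] (hδ : 0 < δ) (hσ : ∀ᵐ τ ∂σ, δ ≤ τ.im ∧ ‖τ‖ ≤ M) {ε : ℝ}
    (hε : 0 < ε) {z : ℂ} (hz : z ∈ upperHalf) {w : ℂ → ℂ} (hw : Integrable w σ) {f : ℂ → ℂ}
    (hf : MemHardy f) {g : ℝ → ℂ} (hg : IsBoundaryData f g) :
    (∫ τ, (starRingEnd ℂ) (w τ) * f τ ∂σ) +
      (ε : ℂ) ^ 2 * ∫ x : ℝ, (starRingEnd ℂ) (extendSol σ ε z w x) * g x = 2 * Real.pi * f z := by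
  have hε' : (ε : ℂ) ≠ 0 := by exact_mod_cast hε.ne'
  have h1 : Integrable fun x : ℝ => (starRingEnd ℂ) (fnP z x) * g x :=
    (fnP_memLp hz).star.integrable_mul hg.1
  have h2 : Integrable fun x : ℝ => (starRingEnd ℂ) (opK σ w x) * g x :=
    (memLp_opK hδ hσ hw).star.integrable_mul hg.1
  -- On the real line `ε² u = p_z - 𝒦w`. The first term evaluates `f` at `z`; the second is the
  -- pairing over `σ` and cancels the one in the claim.
  have h3 : (ε : ℂ) ^ 2 * ∫ x : ℝ, (starRingEnd ℂ) (extendSol σ ε z w x) * g x =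
      (∫ x : ℝ, (starRingEnd ℂ) (fnP z x) * g x) -
        ∫ x : ℝ, (starRingEnd ℂ) (opK σ w x) * g x := by
    rw [← integral_sub h1 h2, ← integral_const_mul]
    refine integral_congr_ae (ae_of_all _ fun x => ?_)
    simp only [extendSol, map_div₀, map_sub, map_pow, Complex.conj_ofReal]
    field_simp
  rw [h3, hf.cauchy_formula hg hz, integral_conj_opK_mul hδ hσ hw hf hg]
  ring

end Equation

/-! ### Positivity of the norms, the value `u(z)`, and the upper bound. -/

section Bounds

variable {σ : Measure ℂ} {δ M : ℝ}

/-- If `w` vanished almost everywhere, so would `𝒦w`, and the equation would force the nowhere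
vanishing `p_z` to be `0` somewhere, as `σ ≠ 0`. -/
theorem IsSolution.normL2_extendSol_pos [IsFiniteMeasure σ] (hσ0 : σ ≠ 0) (hδ : 0 < δ)
    (hσ : ∀ᵐ τ ∂σ, δ ≤ τ.im ∧ ‖τ‖ ≤ M) {ε : ℝ} (hε : 0 < ε) {z : ℂ} (hz : z ∈ upperHalf)
    {w : ℂ → ℂ} (h : IsSolution σ ε z w) : 0 < normL2 σ (extendSol σ ε z w) := by
  have hae := h.extendSol_ae_eq hε
  refine lt_of_le_of_ne ENNReal.toReal_nonneg fun h0 => ?_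
  rw [normL2_congr hae] at h0
  have hw0 := ae_eq_zero_of_normL2_eq_zero h.1 h0.symm
  have : (ae σ).NeBot := ae_neBot.2 hσ0
  obtain ⟨τ, h1, h2, h3⟩ := (h.2.and (hw0.and hσ)).exists
  rw [opK_congr hw0, opK_zero, h2, Pi.zero_apply, mul_zero, add_zero] at h1
  exact fnP_ne_zero hz (hδ.le.trans h3.1) h1.symm

theorem IsSolution.hardyNorm_extendSol_pos [IsFiniteMeasure σ] (hσ0 : σ ≠ 0) (hδ : 0 < δ)
    (hσ : ∀ᵐ τ ∂σ, δ ≤ τ.im ∧ ‖τ‖ ≤ M) {ε : ℝ} (hε : 0 < ε) {z : ℂ} (hz : z ∈ upperHalf)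
    {w : ℂ → ℂ} (h : IsSolution σ ε z w) : 0 < hardyNorm (extendSol σ ε z w) := by
  have hH := memHardy_extendSol (ε := ε) hδ hσ hz (h.1.integrable (by norm_num))
  have hB := hH.isBoundaryData_boundaryData
  refine lt_of_le_of_ne ENNReal.toReal_nonneg fun h0 => ?_
  have hg0 := ae_eq_zero_of_normL2_eq_zero hB.1 h0.symm
  -- By the Cauchy formula, zero boundary data force the function to vanish throughout `ℍ₊`, hence
  -- on `σ`, where its norm is positive.
  have hzero : ∀ ζ ∈ upperHalf, extendSol σ ε z w ζ = 0 := by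
    intro ζ hζ
    have h1 := hH.cauchy_formula hB hζ
    have h2 : ∫ x : ℝ, (starRingEnd ℂ) (fnP ζ x) * boundaryData (extendSol σ ε z w) x = 0 := by
      rw [← integral_zero ℝ ℂ (μ := volume)]
      refine integral_congr_ae ?_
      filter_upwards [hg0] with x hx
      rw [hx, Pi.zero_apply, mul_zero]
    rw [h2] at h1
    have hpi : (Real.pi : ℂ) ≠ 0 := by exact_mod_cast Real.pi_ne_zero
    simpa [hpi] using h1.symm
  have hpos := h.normL2_extendSol_pos hσ0 hδ hσ hε hz
  have hae : extendSol σ ε z w =ᵐ[σ] 0 := by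
    filter_upwards [hσ] with τ hτ using hzero τ (hδ.trans_le hτ.1)
  rw [normL2_congr hae] at hpos
  simp [normL2] at hpos

/-- The representation of evaluation at `z`, applied to `u` itself, turns both pairings into squared
norms. -/
theorem IsSolution.extendSol_apply [IsFiniteMeasure σ] (hδ : 0 < δ)
    (hσ : ∀ᵐ τ ∂σ, δ ≤ τ.im ∧ ‖τ‖ ≤ M) {ε : ℝ} (hε : 0 < ε) {z : ℂ} (hz : z ∈ upperHalf)
    {w : ℂ → ℂ} (h : IsSolution σ ε z w) :
    extendSol σ ε z w z = (((normL2 σ (extendSol σ ε z w) ^ 2 +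
      ε ^ 2 * hardyNorm (extendSol σ ε z w) ^ 2) / (2 * Real.pi) : ℝ) : ℂ) := by
  have hw : Integrable w σ := h.1.integrable (by norm_num)
  have hH := memHardy_extendSol (ε := ε) hδ hσ hz hw
  have hB := isBoundaryData_extendSol (ε := ε) hδ hσ hz hw
  have hae := h.extendSol_ae_eq hε
  have h1 := integral_extendSol hδ hσ hε hz hw hH hB
  have h2 : ∫ τ, (starRingEnd ℂ) (w τ) * extendSol σ ε z w τ ∂σ =
      ((normL2 σ (extendSol σ ε z w) ^ 2 : ℝ) : ℂ) := by
    rw [normL2_congr hae, ← integral_conj_mul_self h.1]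
    refine integral_congr_ae ?_
    filter_upwards [hae] with τ hτ
    rw [hτ]
  rw [h2, integral_conj_mul_self hB.1, ← hH.hardyNorm_eq hB] at h1
  have hpi : (Real.pi : ℂ) ≠ 0 := by exact_mod_cast Real.pi_ne_zero
  push_cast at h1 ⊢
  field_simp
  linear_combination -h1

/-- Cauchy-Schwarz in each of the two pairings that represent `2π f(z)`. -/
theorem IsSolution.norm_apply_le [IsFiniteMeasure σ] (hδ : 0 < δ)
    (hσ : ∀ᵐ τ ∂σ, δ ≤ τ.im ∧ ‖τ‖ ≤ M) {ε : ℝ} (hε : 0 < ε) {z : ℂ} (hz : z ∈ upperHalf)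
    {w : ℂ → ℂ} (h : IsSolution σ ε z w) {f : ℂ → ℂ} (hf : MemHardy f) (hf1 : hardyNorm f ≤ 1)
    (hf2 : normL2 σ f ≤ ε) :
    2 * Real.pi * ‖f z‖ ≤ normL2 σ (extendSol σ ε z w) * ε +
      ε ^ 2 * hardyNorm (extendSol σ ε z w) := by
  have hw : Integrable w σ := h.1.integrable (by norm_num)
  have hH := memHardy_extendSol (ε := ε) hδ hσ hz hw
  have hB := isBoundaryData_extendSol (ε := ε) hδ hσ hz hw
  have hg := hf.isBoundaryData_boundaryData
  have h1 := congrArg norm (integral_extendSol hδ hσ hε hz hw hf hg)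
  have h2 : ‖(2 * Real.pi * f z : ℂ)‖ = 2 * Real.pi * ‖f z‖ := by
    rw [norm_mul, norm_mul, Complex.norm_real, Real.norm_of_nonneg Real.pi_pos.le]
    simp
  rw [← h2, ← h1]
  refine (norm_add_le _ _).trans (add_le_add ?_ ?_)
  · refine (norm_integral_conj_mul_le h.1 (hf.memLp_of_compact hδ hσ)).trans ?_
    rw [normL2_congr (h.extendSol_ae_eq hε)]
    exact mul_le_mul_of_nonneg_left hf2 ENNReal.toReal_nonneg
  · rw [norm_mul, norm_pow, Complex.norm_real, Real.norm_of_nonneg hε.le]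
    refine mul_le_mul_of_nonneg_left ?_ (by positivity)
    refine (norm_integral_conj_mul_le hB.1 hg.1).trans ?_
    rw [hH.hardyNorm_eq hB]
    exact mul_le_of_le_one_right ENNReal.toReal_nonneg hf1

theorem MemHardy.hardyNorm_mul_const {u : ℂ → ℂ} (hu : MemHardy u) {m : ℝ} (hm : 0 ≤ m) :
    hardyNorm (fun ζ => u ζ * (m : ℂ)) = hardyNorm u * m := by
  have h1 := hu.const_mul (m : ℂ)
  have h2 := hu.isBoundaryData_boundaryData.const_mul (m : ℂ)
  simp_rw [mul_comm (m : ℂ)] at h1 h2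
  rw [h1.hardyNorm_eq h2, normL2_mul_const _ hm, hardyNorm]

end Bounds

/-! ### Arc length measure of the curve. -/

section Curve

variable {γ : ℝ → ℂ} {a b : ℝ}

theorem IsSimpleC1Curve.continuousOn_derivWithin (hγ : IsSimpleC1Curve γ a b) :
    ContinuousOn (derivWithin γ (Icc a b)) (Icc a b) :=
  hγ.contDiffOn.continuousOn_derivWithin (uniqueDiffOn_Icc hγ.lt) le_rfl

theorem IsSimpleC1Curve.aemeasurable (hγ : IsSimpleC1Curve γ a b) :
    AEMeasurable γ ((volume.restrict (Icc a b)).withDensity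
      fun t => ‖derivWithin γ (Icc a b) t‖ₑ) :=
  (hγ.contDiffOn.continuousOn.aemeasurable measurableSet_Icc).mono_ac
    (withDensity_absolutelyContinuous _ _)

theorem IsSimpleC1Curve.isFiniteMeasure_arcLength (hγ : IsSimpleC1Curve γ a b) :
    IsFiniteMeasure (arcLength γ a b) := by
  have h := (hγ.continuousOn_derivWithin.integrableOn_compact (μ := volume) isCompact_Icc).2
  have : IsFiniteMeasure ((volume.restrict (Icc a b)).withDensity
      fun t => ‖derivWithin γ (Icc a b) t‖ₑ) := isFiniteMeasure_withDensity h.ne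
  exact Measure.isFiniteMeasure_map _ _

theorem IsSimpleC1Curve.arcLength_ne_zero (hγ : IsSimpleC1Curve γ a b) :
    arcLength γ a b ≠ 0 := by
  have hm : AEMeasurable (fun t => ‖derivWithin γ (Icc a b) t‖ₑ) (volume.restrict (Icc a b)) :=
    (hγ.continuousOn_derivWithin.aestronglyMeasurable measurableSet_Icc).enorm
  rw [arcLength, Ne, Measure.map_eq_zero_iff hγ.aemeasurable, withDensity_eq_zero_iff hm]
  intro h
  have h1 : ∀ᵐ t ∂(volume.restrict (Icc a b)), False := by
    filter_upwards [h, ae_restrict_mem measurableSet_Icc] with t ht ht'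
    exact hγ.regular t ht' (by simpa using ht)
  rw [eventually_false_iff_eq_bot, ae_eq_bot, Measure.restrict_eq_zero, Real.volume_Icc,
    ENNReal.ofReal_eq_zero] at h1
  linarith [hγ.lt]

theorem IsSimpleC1Curve.ae_mem_arcLength (hγ : IsSimpleC1Curve γ a b) :
    ∀ᵐ τ ∂(arcLength γ a b), τ ∈ γ '' Icc a b := by
  have hc : IsCompact (γ '' Icc a b) :=
    isCompact_Icc.image_of_continuousOn hγ.contDiffOn.continuousOn
  rw [arcLength]
  refine (ae_map_iff (p := fun τ => τ ∈ γ '' Icc a b) hγ.aemeasurable hc.measurableSet).2 ?_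
  refine (withDensity_absolutelyContinuous _ _).ae_le ?_
  filter_upwards [ae_restrict_mem measurableSet_Icc] with t ht using mem_image_of_mem γ ht

/-- By compactness `Im` attains a positive minimum on the curve; this gap `δ` keeps the poles `τ̄`
off the closed half-plane. -/
theorem IsSimpleC1Curve.exists_bounds (hγ : IsSimpleC1Curve γ a b)
    (hΓ : γ '' Icc a b ⊆ upperHalf) : ∃ δ M : ℝ, 0 < δ ∧
      ∀ᵐ τ ∂(arcLength γ a b), δ ≤ τ.im ∧ ‖τ‖ ≤ M := by
  have hc : IsCompact (γ '' Icc a b) :=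
    isCompact_Icc.image_of_continuousOn hγ.contDiffOn.continuousOn
  obtain ⟨τ₀, h₀, hmin⟩ := hc.exists_isMinOn ((nonempty_Icc.2 hγ.lt.le).image γ)
    Complex.continuous_im.continuousOn
  obtain ⟨M, hM⟩ := hc.isBounded.exists_norm_le
  exact ⟨τ₀.im, M, hΓ h₀, hγ.ae_mem_arcLength.mono fun τ hτ => ⟨hmin hτ, hM τ hτ⟩⟩

end Curve

/-! ### The main theorem. -/

theorem theorem2p1 (γ : ℝ → ℂ) (a b : ℝ) (hγ : IsSimpleC1Curve γ a b)
    (hΓ : γ '' Icc a b ⊆ upperHalf) (z : ℂ) (hz : z ∈ upperHalf \ γ '' Icc a b)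
    (ε : ℝ) (hε : 0 < ε) :
    -- the integral equation has exactly one solution in `L²(Γ)`
    (∃ w, IsSolution (arcLength γ a b) ε z w) ∧
    (∀ w₁ w₂, IsSolution (arcLength γ a b) ε z w₁ → IsSolution (arcLength γ a b) ε z w₂ →
      w₁ =ᵐ[arcLength γ a b] w₂) ∧
    ∀ w u : ℂ → ℂ, IsSolution (arcLength γ a b) ε z w → u = extendSol (arcLength γ a b) ε z w →
      -- the right-hand side of the bound is meaningful
      u =ᵐ[arcLength γ a b] w ∧ MemHardy u ∧
      0 < hardyNorm u ∧ 0 < normL2 (arcLength γ a b) u ∧ (u z).im = 0 ∧ 0 < (u z).re ∧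
      -- the bound
      (∀ f : ℂ → ℂ, MemHardy f → hardyNorm f ≤ 1 → normL2 (arcLength γ a b) f ≤ ε →
        ‖f z‖ ≤ 3 / 2 * (u z).re * minFactor (arcLength γ a b) ε u) ∧
      -- the function `M = u · min{…}` is admissible and attains the bound up to the factor `3/2`
      (∀ M : ℂ → ℂ, M = (fun ζ => u ζ * (minFactor (arcLength γ a b) ε u : ℂ)) →
        MemHardy M ∧ hardyNorm M ≤ 1 ∧ normL2 (arcLength γ a b) M ≤ ε ∧
        ‖M z‖ = (u z).re * minFactor (arcLength γ a b) ε u) := by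
  have hσfin := hγ.isFiniteMeasure_arcLength
  have hσ0 := hγ.arcLength_ne_zero
  obtain ⟨δ, M, hδ, hσ⟩ := hγ.exists_bounds hΓ
  -- The curve enters through a finite nonzero measure carried by a compact part of `ℍ₊`.
  generalize arcLength γ a b = σ at hσfin hσ0 hσ ⊢
  have hz' : z ∈ upperHalf := hz.1
  refine ⟨exists_isSolution hδ hσ hε hz', fun w₁ w₂ h₁ h₂ => h₁.ae_eq hδ hσ hε h₂, ?_⟩
  rintro w u hw rfl
  have hH := memHardy_extendSol (ε := ε) hδ hσ hz' (hw.1.integrable (by norm_num))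
  have hA := hw.normL2_extendSol_pos hσ0 hδ hσ hε hz'
  have hB := hw.hardyNorm_extendSol_pos hσ0 hδ hσ hε hz'
  have huz := hw.extendSol_apply hδ hσ hε hz'
  have hbound := fun f hf h1 h2 => hw.norm_apply_le (f := f) hδ hσ hε hz' hf h1 h2
  have hae := hw.extendSol_ae_eq hε
  generalize extendSol σ ε z w = u at *
  set A := normL2 σ u with hAdef
  set B := hardyNorm u with hBdef
  have hpi := Real.pi_pos
  have hre : (u z).re = (A ^ 2 + ε ^ 2 * B ^ 2) / (2 * Real.pi) := by
    rw [huz, Complex.ofReal_re]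
  have hrepos : 0 < (u z).re := by rw [hre]; positivity
  have hm : 0 < minFactor σ ε u := lt_min (by positivity) (by positivity)
  refine ⟨hae, hH, hB, hA, by rw [huz, Complex.ofReal_im], hrepos, fun f hf h1 h2 => ?_, ?_⟩
  · have h3 := hbound f hf h1 h2
    have h4 : 0 ≤ 3 / 2 * (u z).re := by positivity
    rw [minFactor, mul_min_of_nonneg _ _ h4, hre]
    refine le_min ?_ ?_
    -- With `p = A` and `q = ε B` the claim is `p q + q² ≤ 3/2 (p² + q²)`, from `p q ≤ (p² + q²) /
    -- 2` and `q² ≤ p² + q²`. The second bound is the same with `p² + p q` on the left, up to a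
    -- factor `ε`.
    · rw [mul_one_div, le_div_iff₀ hB, ← mul_div_assoc, le_div_iff₀ (by positivity)]
      nlinarith [mul_le_mul_of_nonneg_left h3 hB.le, sq_nonneg (A - ε * B), sq_nonneg A]
    · rw [← mul_div_assoc, le_div_iff₀ hA, ← mul_div_assoc, div_mul_eq_mul_div,
        le_div_iff₀ (by positivity)]
      have h5 : A * (A * ε + ε ^ 2 * B) ≤ 3 / 2 * (A ^ 2 + ε ^ 2 * B ^ 2) * ε := by
        nlinarith [mul_nonneg hε.le (sq_nonneg (A - ε * B)),
          mul_nonneg hε.le (sq_nonneg (ε * B))]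
      nlinarith [mul_le_mul_of_nonneg_left h3 hA.le]
  · rintro _ rfl
    refine ⟨?_, ?_, ?_, ?_⟩
    · have h1 := hH.const_mul (minFactor σ ε u : ℂ)
      simp_rw [mul_comm (minFactor σ ε u : ℂ)] at h1
      exact h1
    · rw [hH.hardyNorm_mul_const hm.le, ← hBdef]
      have h1 : minFactor σ ε u ≤ 1 / B := min_le_left _ _
      rw [le_div_iff₀ hB] at h1
      linarith
    · rw [normL2_mul_const _ hm.le, ← hAdef]
      have h1 : minFactor σ ε u ≤ ε / A := min_le_right _ _
      rw [le_div_iff₀ hA] at h1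
      linarith
    · rw [norm_mul, Complex.norm_real, Real.norm_of_nonneg hm.le, huz, Complex.norm_real,
        Real.norm_of_nonneg (by positivity), Complex.ofReal_re]
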